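/- **Setting.** Let $G=(\mathcal V,\mathcal E)$ be a connected undirected graph with $N$ vertices (agents), $\mathcal N_i$ the neighbours of $i$, and $n\ge 1$. Each agent $i$ has a cost $f_i:\mathbb R^n\to\mathbb R$ that is $\underline\lambda$-strongly convex and $\bar\lambda$-smooth, $\underline\lambda>0$. Let $x^*=\arg\min_x\sum_i f_i(x)$ and $\mathbf x^*=(x^*,\dots,x^*)\in\mathbb R^{nN}$; norms are Euclidean. **Quantized coordination.** For $\Delta>0$ let $q(v)=\Delta\,\mathrm{round}(v/\Delta)$ componentwise. Given $\mathbf y=(y_i)_{i}$, a penalty $\rho>0$ and auxiliary vectors $z^0_{ij}\in\mathbb R^n$ ($i\in\mathcal V$, $j\in\mathcal N_i$), set for $\ell\ge 0$ $$w_i^\ell=\frac{1}{1+\rho|\mathcal N_i|}\Big(y_i+\sum_{j\in\mathcal N_i}z_{ij}^\ell\Big),\qquad z_{ij}^{\ell+1}=\tfrac12\big(z_{ij}^\ell+q(-z_{ji}^\ell+2\rho w_j^\ell)\big).$$ Let $d(z^0)$ be the distance of $z^0$ from the fixed points of the same recursion with $q$ replaced by the identity. Each agent $i$ returns $w_i^{\ell_i}$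 for some $\ell_i$ such that either the termination test $\|z_{ab}^{m+1}-z_{ab}^m\|\le\theta=c\Delta$ ($c>0$ fixed) has been passed simultaneously by all $a\in\mathcal V$, $b\in\mathcal N_a$ in some round $m\le\ell_i$, or $$\ell_i\ \ge\ \bar\ell:=\left|\frac1{\log\mu}\log\frac{\frac\Delta2\sqrt{n\sum_j|\mathcal N_j|}}{(1-\mu)\,d(z^0)}\right|,$$ where $\mu\in(0,1)$ is the constant of the statement below (if the argument of the outer logarithm is not positive and finite, $\bar\ell:=0$). The vectors $z^0$ and the indices $\ell_i$ may be random and may change from one call to the next. **Algorithm.** Let $0<\alpha<2/\bar\lambda$ and let $\mathbf x_0$ be given. At iteration $k$, an active agent computes $y_{i,k}=x_{i,k}-\alpha\hat\nabla f_i(x_{i,k})$ and an inactive one keeps $y_{i,k}=y_{i,k-1}$; at $k=0$, where no previous value exists, all agents compute $y_{i,0}$. Then $\mathbf x_{k+1}$ is the result of the quantized coordination applied to $\mathbf y_k$. At each iteration $k\ge1$ agent $i$ is active with probability $p_i\in(0,1]$ independently of everything that happened before iteration $k$, and $\hat\nabla f_i$ is computed with a fresh random sample, independent of everything that happened before iteration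 $k$, with $\mathbb E\|\hat\nabla f_i(x)-\nabla f_i(x)\|\le\tau$ for every $x\in\mathbb R^n$. **Proposition.** For every such graph, $\rho$ and $c$ there are $\mu\in(0,1)$ and $C>0$, depending on nothing else, such that for every trajectory of the algorithm and all $k>0$ $$\mathbb E\|\mathbf x_k-\mathbf x^*\|\le\sqrt{\frac{\max_ip_i}{\min_ip_i}}\left(\chi^k\|\mathbf x_0-\mathbf x^*\|+\big(\gamma+\alpha\tau\sqrt N\big)\frac{1-\chi^k}{1-\chi}\right),$$ where $\zeta=\max\{|1-\alpha\underline\lambda|,|1-\alpha\bar\lambda|\}$, $\chi=\sqrt{1-(1-\zeta^2)\min_ip_i}\in[0,1)$, with $\chi>0$ unless $\zeta=0$ and all $p_i=1$, and $$\gamma=\sqrt N\,C\,\frac{\Delta}{2}\sqrt{n\sum_{i\in\mathcal V}|\mathcal N_i|}\;\frac1{1-\mu}=O(\Delta).$$ -/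

import Mathlib

open MeasureTheory ProbabilityTheory

noncomputable section

namespace FTQC

/-- Local states live in `ℝⁿ` with the Euclidean norm. -/
abbrev Vec (n : ℕ) : Type := EuclideanSpace ℝ (Fin n)

/-- Auxiliary variables `z = [z_{ij}]`, one vector of `ℝⁿ` for every ordered pair `(i, j)` of
neighbours (a dart `d` with `d.fst = i`, `d.snd = j`), with the Euclidean norm of the stacked
vector. -/
abbrev EdgeVec {V : Type*} (G : SimpleGraph V) (n : ℕ) : Type _ :=
  PiLp 2 (fun _ : G.Dart => Vec n)

/-- Euclidean norm of a stacked vector `[v_1, …, v_N]` in `ℝ^{nN}`. -/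
def stackNorm {V : Type*} [Fintype V] {n : ℕ} (v : V → Vec n) : ℝ :=
  ‖(WithLp.toLp 2 v : PiLp 2 (fun _ : V => Vec n))‖

/-- The symmetric quantizer `q(x) = Δ * round (x / Δ)`, applied to each component. -/
def quantize {n : ℕ} (Δ : ℝ) (v : Vec n) : Vec n :=
  WithLp.toLp 2 (fun j => Δ * (round (v j / Δ) : ℝ))

/-- The local update `w_i = (y_i + ∑_{j ∈ N_i} z_{ij}) / (1 + ρ |N_i|)` of consensus ADMM. -/
def localUpdate {V : Type*} [Fintype V] [DecidableEq V] (G : SimpleGraph V)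
    [DecidableRel G.Adj] {n : ℕ} (ρ : ℝ) (y : V → Vec n) (z : EdgeVec G n) (i : V) : Vec n :=
  (1 + ρ * (G.degree i : ℝ))⁻¹ • (y i + ∑ d : G.Dart with d.fst = i, z d)

/-- The message `t_{i → j} = q (- z_{ij} + 2 ρ w_i)`, where `d` is the ordered pair `(i, j)`. -/
def message {V : Type*} [Fintype V] [DecidableEq V] (G : SimpleGraph V)
    [DecidableRel G.Adj] {n : ℕ} (ρ : ℝ) (q : Vec n → Vec n) (y : V → Vec n)
    (z : EdgeVec G n) (d : G.Dart) : Vec n :=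
  q (-(z d) + (2 * ρ) • localUpdate G ρ y z d.fst)

/-- The auxiliary update `z_{ij} ← (z_{ij} + t_{j → i}) / 2`. -/
def admmStep {V : Type*} [Fintype V] [DecidableEq V] (G : SimpleGraph V)
    [DecidableRel G.Adj] {n : ℕ} (ρ : ℝ) (q : Vec n → Vec n) (y : V → Vec n)
    (z : EdgeVec G n) : EdgeVec G n :=
  WithLp.toLp 2 (fun d => (1 / 2 : ℝ) • (z d + message G ρ q y z d.symm))

/-- The auxiliary variables `z^ℓ` after `ℓ` rounds with quantized communications. -/
def zIter {V : Type*} [Fintype V] [DecidableEq V] (G : SimpleGraph V)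
    [DecidableRel G.Adj] {n : ℕ} (ρ Δ : ℝ) (y : V → Vec n) (z₀ : EdgeVec G n) (l : ℕ) :
    EdgeVec G n :=
  (admmStep G ρ (quantize Δ) y)^[l] z₀

/-- The local states `w_i^ℓ` of the quantized coordination scheme. -/
def wIter {V : Type*} [Fintype V] [DecidableEq V] (G : SimpleGraph V)
    [DecidableRel G.Adj] {n : ℕ} (ρ Δ : ℝ) (y : V → Vec n) (z₀ : EdgeVec G n) (l : ℕ)
    (i : V) : Vec n :=
  localUpdate G ρ y (zIter G ρ Δ y z₀ l) i

/-- `d(z)`: the distance of `z` from the set of fixed points of the scheme without quantization. -/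
def fixDist {V : Type*} [Fintype V] [DecidableEq V] (G : SimpleGraph V)
    [DecidableRel G.Adj] {n : ℕ} (ρ : ℝ) (y : V → Vec n) (z : EdgeVec G n) : ℝ :=
  Metric.infDist z {z' : EdgeVec G n | admmStep G ρ id y z' = z'}

/-- `(Δ / 2) * √(n ∑_i |N_i|)`, the size of the quantization error of one round. -/
def quantError {V : Type*} [Fintype V] (G : SimpleGraph V) [DecidableRel G.Adj]
    (n : ℕ) (Δ : ℝ) : ℝ :=
  Δ / 2 * √((n : ℝ) * ∑ i, (G.degree i : ℝ))

/-- The number of rounds `ℓ̄ = |log(E / ((1 - μ) d(z⁰))) / log μ|` with `E` the quantization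
error of one round. -/
def roundBound {V : Type*} [Fintype V] [DecidableEq V] (G : SimpleGraph V)
    [DecidableRel G.Adj] {n : ℕ} (ρ Δ μ : ℝ) (y : V → Vec n) (z₀ : EdgeVec G n) : ℝ :=
  |1 / Real.log μ * Real.log (quantError G n Δ / ((1 - μ) * fixDist G ρ y z₀))|

/-- The coordination scheme may be left after `l` rounds: either the termination test
`‖z_{ij}^{m+1} - z_{ij}^m‖ ≤ θ` has been passed on all edges in some round `m ≤ l`,
or at least `ℓ̄` rounds were made. -/
def MayStop {V : Type*} [Fintype V] [DecidableEq V] (G : SimpleGraph V)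
    [DecidableRel G.Adj] {n : ℕ} (ρ Δ θ μ : ℝ) (y : V → Vec n) (z₀ : EdgeVec G n)
    (l : ℕ) : Prop :=
  (∃ m ≤ l, ∀ d : G.Dart, ‖zIter G ρ Δ y z₀ (m + 1) d - zIter G ρ Δ y z₀ m d‖ ≤ θ) ∨
    roundBound G ρ Δ μ y z₀ ≤ (l : ℝ)

/-- `x, y` is a trajectory of the asynchronous gradient method with quantized coordination.
`grad i u s` is the inexact gradient of agent `i` at `u` computed with the random sample `s`,
`ξ k i` the sample of agent `i` at iteration `k`, `active k i` the event that `i` is active at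
iteration `k`. At iteration `k` the coordination scheme starts from the auxiliary variables
`z₀ k`, and agent `i` leaves it after `L k i` rounds. An inactive agent keeps its previous
`y_i`; at iteration `0` there is no previous value, and every agent computes its `y_i`. -/
structure IsTrajectory {V Ω Ξ : Type*} [Fintype V] [DecidableEq V] (G : SimpleGraph V)
    [DecidableRel G.Adj] {n : ℕ} (ρ Δ θ μ α : ℝ)
    (grad : V → Vec n → Ξ → Vec n) (ξ : ℕ → V → Ω → Ξ) (active : ℕ → V → Set Ω)
    (z₀ : ℕ → Ω → EdgeVec G n) (L : ℕ → V → Ω → ℕ) (x₀ : V → Vec n)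
    (x y : ℕ → Ω → V → Vec n) : Prop where
  init : ∀ ω, x 0 ω = x₀
  first_step : ∀ ω i, y 0 ω i = x 0 ω i - α • grad i (x 0 ω i) (ξ 0 i ω)
  active_step : ∀ k ω i, ω ∈ active (k + 1) i →
    y (k + 1) ω i = x (k + 1) ω i - α • grad i (x (k + 1) ω i) (ξ (k + 1) i ω)
  idle_step : ∀ k ω i, ω ∉ active (k + 1) i → y (k + 1) ω i = y k ω i
  stopped : ∀ k ω i, MayStop G ρ Δ θ μ (y k ω) (z₀ k ω) (L k i ω)
  coordination : ∀ k ω i, x (k + 1) ω i = wIter G ρ Δ (y k ω) (z₀ k ω) (L k i ω) i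

/-- The local cost is `lamL`-strongly convex and `lamU`-smooth. -/
structure StronglyConvexSmooth {n : ℕ} (lamL lamU : ℝ) (f : Vec n → ℝ) : Prop where
  strongConvex : StrongConvexOn Set.univ lamL f
  differentiable : Differentiable ℝ f
  smooth : ∀ u v, ‖gradient f u - gradient f v‖ ≤ lamU * ‖u - v‖

/-- The random set-up. `ℱ k` is the information available before iteration `k`. Given this
information agent `i` is active at iteration `k` with probability `p i`. The samples `ξ k i` are
independent of it, and the inexact gradients have expected error at most `τ` at every point.
Nothing is assumed on the dependence among agents, nor between activations and samples of the
same iteration. -/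
structure RandomSetup {V Ω Ξ : Type*} [MeasurableSpace Ω] [MeasurableSpace Ξ]
    {G : SimpleGraph V} {n : ℕ} [Fintype V] [DecidableRel G.Adj] (P : Measure Ω)
    (ℱ : Filtration ℕ (inferInstance : MeasurableSpace Ω)) (f : V → Vec n → ℝ)
    (p : V → ℝ) (τ : ℝ) (grad : V → Vec n → Ξ → Vec n) (ξ : ℕ → V → Ω → Ξ)
    (active : ℕ → V → Set Ω) (z₀ : ℕ → Ω → EdgeVec G n) (L : ℕ → V → Ω → ℕ) : Prop where
  measurable_grad : ∀ i, Measurable (Function.uncurry (grad i))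
  measurable_sample : ∀ k i, Measurable[ℱ (k + 1)] (ξ k i)
  measurable_active : ∀ k i, MeasurableSet[ℱ (k + 1)] (active k i)
  measurable_aux : ∀ k, Measurable[ℱ (k + 1)] (z₀ k)
  measurable_rounds : ∀ k i, Measurable[ℱ (k + 1)] (L k i)
  prob_active : ∀ k i s, MeasurableSet[ℱ k] s →
    P (active k i ∩ s) = ENNReal.ofReal (p i) * P s
  indep_sample : ∀ k i,
    Indep (MeasurableSpace.comap (ξ k i) inferInstance) (ℱ k) P
  grad_error : ∀ k i (u : Vec n),
    ∫⁻ ω, ‖grad i u (ξ k i ω) - gradient (f i) u‖ₑ ∂P ≤ ENNReal.ofReal τ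

/-- `ζ = max {|1 - α lamL|, |1 - α lamU|}`. -/
def zeta (α lamL lamU : ℝ) : ℝ := max |1 - α * lamL| |1 - α * lamU|

/-- `χ = √(1 - (1 - ζ²) min_i p_i)`. -/
def chi {V : Type*} (α lamL lamU : ℝ) (p : V → ℝ) : ℝ :=
  √(1 - (1 - zeta α lamL lamU ^ 2) * ⨅ i, p i)

/-- `γ = √N * C * (Δ / 2) * √(n ∑_i |N_i|) / (1 - μ)`. -/
def coordError {V : Type*} [Fintype V] (G : SimpleGraph V) [DecidableRel G.Adj]
    (n : ℕ) (Δ C μ : ℝ) : ℝ :=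
  √(Fintype.card V : ℝ) * C * quantError G n Δ / (1 - μ)

end FTQC

end

/-!
The bound rests on three estimates.

*Coordination.* A round of the unquantized scheme is `z ↦ (z + R z + b) / 2` with `R` a linear
nonexpansive map acting in the same way on all `n` components of the local states, so that it may
be studied on one scalar per dart. By strict convexity of the Euclidean norm, such an average
contracts the component orthogonal to the fixed points of `R` by some `μ < 1`
(`exists_contraction_fixPerp`), and this component alone controls the distance of the local states
to the average of `y` (`norm_localUpdate_sub_mean_le`). The other component may drift under the
quantization errors, which is harmless. A passed termination test bounds the contracted component
because a contracted step is short only near its fixed points; enough rounds bound it because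
`μ ^ l` is small. This gives `exists_coordination_bound`.

*Gradient steps.* The gradient of `f - m / 2 ‖·‖²` is cocoercive, so a gradient step is Lipschitz
with constant `ζ < 1` (`norm_gradientStep_sub_le`), and it maps the minimizer to vectors whose
average is the minimizer.

*Randomness.* The local variables `y` are compared with the trajectory `exactTraj`, which has the
same activations but exact gradients and exact averages. For the latter, the sum of the squared
errors weighted by `1 / p i` contracts by `χ²` in expectation; the price of the weights is the
factor `√(max p / min p)`. The gradient errors of different agents may be dependent and only their
first moments are bounded, so the deviation from `exactTraj` is not estimated in a Euclidean norm,
where it would cost a factor `N`, but by the maximum over the agents of the expected norms. That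
quantity contracts by `1 - p i + p i ζ ≤ χ` (`IsTrajectory.lintegral_deviation_le`), and averaging
over the agents turns it into an error of size `√N` in the stacked norm.
-/

namespace FTQC

/-! ### Averages of nonexpansive linear maps -/

section AveragedOperators

variable {H : Type*} [NormedAddCommGroup H] [InnerProductSpace ℝ H] [FiniteDimensional ℝ H]

/-- The component of a vector orthogonal to the fixed points of `R`, as a linear map. -/
noncomputable def fixPerp (R : H →L[ℝ] H) : H →L[ℝ] H :=
  ((1 - R).toLinearMap.ker)ᗮ.starProjection

lemma norm_fixPerp_le (R : H →L[ℝ] H) (v : H) : ‖fixPerp R v‖ ≤ ‖v‖ :=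
  Submodule.norm_starProjection_apply_le _ v

lemma fixPerp_eq_zero (R : H →L[ℝ] H) {v : H} (hv : R v = v) : fixPerp R v = 0 := by
  rw [fixPerp, Submodule.starProjection_apply_eq_zero_iff, Submodule.orthogonal_orthogonal]
  simp [hv]

lemma apply_sub_fixPerp (R : H →L[ℝ] H) (v : H) : R (v - fixPerp R v) = v - fixPerp R v := by
  have h : v - fixPerp R v ∈ ((1 - R).toLinearMap.ker)ᗮᗮ :=
    Submodule.sub_starProjection_mem_orthogonal v
  rw [Submodule.orthogonal_orthogonal] at h
  have h' : (v - fixPerp R v) - R (v - fixPerp R v) = 0 := by simpa using h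
  exact (sub_eq_zero.1 h').symm

lemma fixPerp_fixPerp_add (R : H →L[ℝ] H) (v : H) :
    fixPerp R ((1 / 2 : ℝ) • (v + R v)) =
      fixPerp R ((1 / 2 : ℝ) • (fixPerp R v + R (fixPerp R v))) := by
  have h0 : R (v - fixPerp R v) = v - fixPerp R v := apply_sub_fixPerp R v
  have h1 : fixPerp R ((1 / 2 : ℝ) • ((v - fixPerp R v) + R (v - fixPerp R v))) = 0 := by
    apply fixPerp_eq_zero
    rw [h0, map_smul, map_add, h0]
  rw [← sub_eq_zero, ← map_sub, ← h1, map_sub R]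
  congr 1
  module

/-- The average `(1 + R) / 2` of the identity and a nonexpansive map `R` of a finite-dimensional
space contracts the component orthogonal to the fixed points of `R`. -/
lemma exists_contraction_fixPerp (R : H →L[ℝ] H) (hR : ∀ v, ‖R v‖ ≤ ‖v‖) :
    ∃ μ : ℝ, 0 < μ ∧ μ < 1 ∧
      ∀ v, ‖fixPerp R ((1 / 2 : ℝ) • (v + R v))‖ ≤ μ * ‖fixPerp R v‖ := by
  set K := (1 - R).toLinearMap.ker with hK
  -- `1 - R` is injective on the orthogonal complement, hence bounded below there.
  obtain ⟨c, hc, hanti⟩ := LinearMap.exists_antilipschitzWith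
    ((1 - R).toLinearMap.domRestrict Kᗮ) (by
      rw [LinearMap.ker_eq_bot']
      intro u hu
      have h1 : (u : H) ∈ K := by simpa [hK] using hu
      have h2 := Submodule.inner_right_of_mem_orthogonal h1 u.2
      ext
      simpa using inner_self_eq_zero.1 h2)
  have hbd : ∀ u ∈ Kᗮ, ‖u‖ ≤ c * ‖u - R u‖ := by
    intro u hu
    have := hanti.le_mul_dist ⟨u, hu⟩ 0
    simpa [dist_zero_right] using this
  have hc' : (0 : ℝ) < c := by exact_mod_cast hc
  -- With `‖u‖ ≤ C ‖u - R u‖`, the parallelogram law gives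
  -- `‖(u + R u) / 2‖² ≤ ‖u‖² - ‖u - R u‖² / 4 ≤ (1 - 1 / (4 C²)) ‖u‖²`; `C > 1` makes the rate
  -- positive.
  set C : ℝ := c + 1 with hC
  have hC1 : 1 < C := by linarith
  have hlt : 1 / (4 * C ^ 2) < 1 := by
    rw [div_lt_one (by positivity)]; nlinarith
  have hpos : 0 < 1 / (4 * C ^ 2) := by positivity
  refine ⟨√(1 - 1 / (4 * C ^ 2)), Real.sqrt_pos.2 (by linarith), ?_, fun v => ?_⟩
  · rw [Real.sqrt_lt' one_pos]; linarith
  · set u := fixPerp R v with hu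
    have humem : u ∈ Kᗮ := Submodule.starProjection_apply_mem _ _
    rw [fixPerp_fixPerp_add]
    refine (norm_fixPerp_le _ _).trans ?_
    have h1 : ‖u‖ ≤ C * ‖u - R u‖ := (hbd u humem).trans (by
      have := norm_nonneg (u - R u); nlinarith)
    have hpar := parallelogram_law_with_norm ℝ u (R u)
    have hRu := hR u
    have h2 : ‖u‖ ^ 2 / C ^ 2 ≤ ‖u - R u‖ ^ 2 := by
      rw [div_le_iff₀ (by positivity)]
      calc ‖u‖ ^ 2 ≤ (C * ‖u - R u‖) ^ 2 := by gcongr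
        _ = _ := by ring
    rw [← hu, norm_smul]
    apply abs_le_of_sq_le_sq' _ (by positivity) |>.2
    rw [mul_pow, mul_pow, Real.sq_sqrt (by linarith)]
    have h3 : ‖R u‖ ^ 2 ≤ ‖u‖ ^ 2 := by gcongr
    have h4 : ‖u‖ ^ 2 / C ^ 2 = 4 * (1 / (4 * C ^ 2) * ‖u‖ ^ 2) := by field_simp
    norm_num
    norm_num at h4
    nlinarith

/-- A nonexpansive map and its adjoint have the same fixed points, so that `v - R v = b` is
solvable as soon as `b` is orthogonal to the fixed points of `R`. -/
lemma exists_sub_apply_eq (R : H →L[ℝ] H) (hR : ∀ v, ‖R v‖ ≤ ‖v‖) (b : H)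
    (hb : ∀ v, R v = v → inner ℝ v b = 0) : ∃ v, v - R v = b := by
  have hmem : b ∈ ((1 - R).toLinearMap.range)ᗮᗮ := by
    rw [Submodule.mem_orthogonal]
    intro v hv
    apply hb
    have hv' : ContinuousLinearMap.adjoint (1 - R) v = 0 := by
      rw [ContinuousLinearMap.orthogonal_range] at hv
      simpa using hv
    have h1 : inner ℝ v (v - R v) = 0 := by
      have := ContinuousLinearMap.adjoint_inner_left (1 - R) v v
      rw [hv', inner_zero_left] at this
      simpa using this.symm
    have h2 : ‖R v - v‖ ^ 2 ≤ 0 := by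
      rw [norm_sub_sq_real]
      rw [inner_sub_right, real_inner_self_eq_norm_sq] at h1
      have h3 : ‖R v‖ ^ 2 ≤ ‖v‖ ^ 2 := by gcongr; exact hR v
      rw [real_inner_comm]
      linarith
    have h4 : ‖R v - v‖ = 0 := by nlinarith [norm_nonneg (R v - v)]
    exact sub_eq_zero.1 (norm_eq_zero.1 h4)
  rw [Submodule.orthogonal_orthogonal] at hmem
  obtain ⟨v, hv⟩ := hmem
  exact ⟨v, by simpa using hv⟩

end AveragedOperators

/-! ### The coordination scheme with scalar local states -/

section ScalarScheme

lemma sum_dart_symm {V : Type*} [Fintype V] {G : SimpleGraph V} [DecidableRel G.Adj]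
    (F : G.Dart → ℝ) : ∑ d : G.Dart, F d.symm = ∑ d, F d :=
  Equiv.sum_comp (SimpleGraph.Dart.symm_involutive.toPerm _) F

variable {V : Type*} [Fintype V] [DecidableEq V] (G : SimpleGraph V) [DecidableRel G.Adj]

/-- The local update for scalar local variables. -/
noncomputable def scalarUpdate (ρ : ℝ) (y : V → ℝ) (v : EuclideanSpace ℝ G.Dart) (i : V) : ℝ :=
  (1 + ρ * (G.degree i : ℝ))⁻¹ * (y i + ∑ d : G.Dart with d.fst = i, v d)

/-- The linear part of the Peaceman–Rachford operator for scalar local variables, the reflected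
message `-z_{ji} + 2ρ w_j` received along the dart `(i, j)` when `y = 0`. -/
noncomputable def reflection (ρ : ℝ) : EuclideanSpace ℝ G.Dart →L[ℝ] EuclideanSpace ℝ G.Dart :=
  LinearMap.toContinuousLinearMap
    { toFun := fun v => WithLp.toLp 2 fun d => -v d.symm + 2 * ρ * scalarUpdate G ρ 0 v d.snd
      map_add' := by
        intro u v
        ext d
        simp only [scalarUpdate, PiLp.add_apply, Finset.sum_add_distrib, Pi.zero_apply]
        ring
      map_smul' := by
        intro a v
        ext d
        simp only [scalarUpdate, PiLp.smul_apply, smul_eq_mul, ← Finset.mul_sum, Pi.zero_apply,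
          RingHom.id_apply]
        ring }

lemma reflection_apply (ρ : ℝ) (v : EuclideanSpace ℝ G.Dart) (d : G.Dart) :
    reflection G ρ v d = -v d.symm + 2 * ρ * scalarUpdate G ρ 0 v d.snd := rfl

variable {G}

lemma sum_dart_eq_sum_vertex (F : G.Dart → ℝ) :
    ∑ d, F d = ∑ i, ∑ d : G.Dart with d.fst = i, F d :=
  (Finset.sum_fiberwise _ _ _).symm

lemma sum_dart_fst (g : V → ℝ) : ∑ d : G.Dart, g d.fst = ∑ i, (G.degree i : ℝ) * g i := by
  rw [sum_dart_eq_sum_vertex]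
  refine Finset.sum_congr rfl fun i _ => ?_
  rw [Finset.sum_congr rfl (g := fun _ => g i) (by intro d hd; simp at hd; rw [hd])]
  rw [Finset.sum_const, nsmul_eq_mul, ← G.dart_fst_fiber_card_eq_degree i]

lemma sum_dart_fst_mul (g : V → ℝ) (v : G.Dart → ℝ) :
    ∑ d : G.Dart, g d.fst * v d = ∑ i, g i * ∑ d : G.Dart with d.fst = i, v d := by
  rw [sum_dart_eq_sum_vertex]
  refine Finset.sum_congr rfl fun i _ => ?_
  rw [Finset.mul_sum]
  exact Finset.sum_congr rfl (by intro d hd; simp at hd; rw [hd])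

lemma norm_reflection_le {ρ : ℝ} (hρ : 0 < ρ) (v : EuclideanSpace ℝ G.Dart) :
    ‖reflection G ρ v‖ ≤ ‖v‖ := by
  apply abs_le_of_sq_le_sq' _ (norm_nonneg _) |>.2
  rw [EuclideanSpace.norm_sq_eq, EuclideanSpace.norm_sq_eq]
  simp only [Real.norm_eq_abs, sq_abs, reflection_apply]
  rw [← sum_dart_symm]
  simp only [SimpleGraph.Dart.symm_symm]
  set w := scalarUpdate G ρ 0 v with hw
  have e1 : ∀ d : G.Dart, (-v d + 2 * ρ * w d.symm.snd) ^ 2 =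
      v d ^ 2 - (4 * ρ) * (w d.fst * v d) + 4 * ρ ^ 2 * (w d.fst) ^ 2 := by
    intro d
    have : d.symm.snd = d.fst := rfl
    rw [this]; ring
  simp only [e1]
  rw [Finset.sum_add_distrib, Finset.sum_sub_distrib, ← Finset.mul_sum, ← Finset.mul_sum,
    sum_dart_fst_mul, sum_dart_fst (fun i => w i ^ 2)]
  have e2 : ∀ i, ∑ d : G.Dart with d.fst = i, v d = (1 + ρ * G.degree i) * w i := by
    intro i
    have : (1 + ρ * (G.degree i : ℝ)) ≠ 0 := by positivity
    rw [hw, scalarUpdate]; field_simp; simp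
  simp only [e2]
  have e3 : ∑ i, w i * ((1 + ρ * G.degree i) * w i) =
      ∑ i, w i ^ 2 + ρ * ∑ i, (G.degree i : ℝ) * w i ^ 2 := by
    rw [Finset.mul_sum, ← Finset.sum_add_distrib]
    exact Finset.sum_congr rfl fun i _ => by ring
  rw [e3]
  have : 0 ≤ ∑ i, w i ^ 2 := Finset.sum_nonneg fun i _ => sq_nonneg _
  nlinarith

/-- At a fixed point of the unquantized scheme all local states agree with the average of `y`. -/
lemma scalarUpdate_eq_mean (hG : G.Connected) {ρ : ℝ} (hρ : 0 < ρ) (y : V → ℝ)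
    (v : EuclideanSpace ℝ G.Dart)
    (hv : ∀ d : G.Dart, v d + v d.symm = 2 * ρ * scalarUpdate G ρ y v d.snd) (i : V) :
    scalarUpdate G ρ y v i = (Fintype.card V : ℝ)⁻¹ * ∑ j, y j := by
  set w := scalarUpdate G ρ y v with hw
  have hadj : ∀ a b, G.Adj a b → w a = w b := by
    intro a b hab
    have h1 := hv ⟨(a, b), hab⟩
    have h2 := hv (SimpleGraph.Dart.symm ⟨(a, b), hab⟩)
    rw [SimpleGraph.Dart.symm_symm] at h2
    have h3 : 2 * ρ * w b = 2 * ρ * w a := by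
      rw [add_comm] at h2
      exact h1.symm.trans h2
    exact (mul_left_cancel₀ (by positivity) h3).symm
  have hconst : ∀ j, w j = w i := by
    intro j
    obtain ⟨p⟩ := hG.preconnected j i
    induction p with
    | nil => rfl
    | cons h _ ih => exact (hadj _ _ h).trans ih
  have e2 : ∀ j, y j + ∑ d : G.Dart with d.fst = j, v d = (1 + ρ * G.degree j) * w i := by
    intro j
    have : (1 + ρ * (G.degree j : ℝ)) ≠ 0 := by positivity
    rw [← hconst j, hw, scalarUpdate]; field_simp
  have hs := Finset.sum_congr (rfl : (Finset.univ : Finset V) = _) fun j _ => e2 j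
  rw [Finset.sum_add_distrib, ← sum_dart_eq_sum_vertex] at hs
  have hd : 2 * ∑ d, v d = 2 * (ρ * ∑ j, (G.degree j : ℝ) * w i) := by
    rw [two_mul]
    nth_rewrite 2 [← sum_dart_symm]
    rw [← Finset.sum_add_distrib, ← sum_dart_fst (fun _ => w i), ← mul_assoc, Finset.mul_sum]
    exact Finset.sum_congr rfl fun d _ => by rw [hv d, hconst]
  have hN : (0 : ℝ) < Fintype.card V := by
    have := hG.nonempty
    exact_mod_cast Fintype.card_pos
  have e3 : ∑ j, (1 + ρ * G.degree j) * w i =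
      Fintype.card V * w i + ρ * ∑ j, (G.degree j : ℝ) * w i := by
    rw [Finset.mul_sum, ← nsmul_eq_mul, ← Finset.card_univ, ← Finset.sum_const,
      ← Finset.sum_add_distrib]
    exact Finset.sum_congr rfl fun j _ => by ring
  rw [e3] at hs
  field_simp
  linarith

lemma add_symm_of_reflection_eq {ρ : ℝ} {v : EuclideanSpace ℝ G.Dart}
    (hv : reflection G ρ v = v) (d : G.Dart) :
    v d + v d.symm = 2 * ρ * scalarUpdate G ρ 0 v d.snd := by
  have := congrArg (fun u : EuclideanSpace ℝ G.Dart => u d) hv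
  simp only [reflection_apply] at this
  linarith

lemma scalarUpdate_eq_zero (hG : G.Connected) {ρ : ℝ} (hρ : 0 < ρ)
    {v : EuclideanSpace ℝ G.Dart} (hv : reflection G ρ v = v) (i : V) :
    scalarUpdate G ρ 0 v i = 0 := by
  rw [scalarUpdate_eq_mean hG hρ 0 v (add_symm_of_reflection_eq hv)]
  simp

/-- The unquantized scheme has a fixed point: its constant term is orthogonal to the fixed points
of the linear part, which are antisymmetric and sum to zero around every vertex. -/
lemma exists_scalar_fixedPoint (hG : G.Connected) {ρ : ℝ} (hρ : 0 < ρ) (y : V → ℝ) :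
    ∃ v : EuclideanSpace ℝ G.Dart,
      ∀ d : G.Dart, v d + v d.symm = 2 * ρ * scalarUpdate G ρ y v d.snd := by
  set g : V → ℝ := fun i => 2 * ρ * ((1 + ρ * (G.degree i : ℝ))⁻¹ * y i) with hg
  obtain ⟨v, hv⟩ := exists_sub_apply_eq (reflection G ρ) (norm_reflection_le hρ)
    (WithLp.toLp 2 fun d => g d.snd) (by
      intro u hu
      have hw := scalarUpdate_eq_zero hG hρ hu
      have hsym : ∀ d, u d.symm = -u d := by
        intro d
        have := add_symm_of_reflection_eq hu d
        rw [hw] at this; linarith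
      have hsum : ∀ i, ∑ d : G.Dart with d.fst = i, u d = 0 := by
        intro i
        have h := hw i
        have : (1 + ρ * (G.degree i : ℝ)) ≠ 0 := by positivity
        simpa [scalarUpdate, this] using h
      rw [PiLp.inner_apply, ← sum_dart_symm]
      have : ∀ d : G.Dart, inner ℝ (u d.symm) (g d.symm.snd) = -(g d.fst * u d) := by
        intro d
        rw [hsym]
        change g d.fst * (-u d) = _
        ring
      simp only [this, Finset.sum_neg_distrib, sum_dart_fst_mul, hsum]
      simp)
  refine ⟨v, fun d => ?_⟩
  have h := congrArg (fun u : EuclideanSpace ℝ G.Dart => u d) hv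
  simp only [PiLp.sub_apply, reflection_apply, hg, scalarUpdate, Pi.zero_apply] at h
  simp only [scalarUpdate]
  linarith

end ScalarScheme

/-! ### Gradient steps for strongly convex functions -/

section GradientStep

variable {E : Type*} [NormedAddCommGroup E] [InnerProductSpace ℝ E]

/-- Two-sided quadratic bounds with curvatures `m` and `m + K` give cocoercivity of the gradient
of `f - m/2 ‖·‖²`. -/
lemma norm_sq_le_mul_inner_of_quadratic_bounds {f : E → ℝ} {g : E → E} {m K : ℝ} (hK : 0 < K)
    (hlow : ∀ u d, f u + inner ℝ (g u) d + m / 2 * ‖d‖ ^ 2 ≤ f (u + d))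
    (hup : ∀ u d, f (u + d) ≤ f u + inner ℝ (g u) d + (m + K) / 2 * ‖d‖ ^ 2) (u v : E) :
    ‖g u - g v - m • (u - v)‖ ^ 2 ≤ K * inner ℝ (g u - g v - m • (u - v)) (u - v) := by
  -- Compare both bounds at the minimizer of the quadratic majorant.
  have key : ∀ u v : E, f v + inner ℝ (g v) (u - v) + m / 2 * ‖u - v‖ ^ 2 +
      (1 / (2 * K)) * ‖g u - g v - m • (u - v)‖ ^ 2 ≤ f u := by
    intro u v
    set q := g u - g v - m • (u - v) with hq
    have h1 := hlow v (u - v - K⁻¹ • q)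
    have h2 := hup u (-(K⁻¹ • q))
    have e : v + (u - v - K⁻¹ • q) = u + -(K⁻¹ • q) := by abel
    rw [e] at h1
    have hgu : g u = q + g v + m • (u - v) := by rw [hq]; abel
    rw [hgu] at h2
    have n1 : ‖u - v - K⁻¹ • q‖ ^ 2 = ‖u - v‖ ^ 2 - 2 * (K⁻¹ * inner ℝ q (u - v)) +
        K⁻¹ ^ 2 * ‖q‖ ^ 2 := by
      rw [norm_sub_sq_real, inner_smul_right, norm_smul, mul_pow, real_inner_comm]
      simp
    have n2 : ‖-(K⁻¹ • q)‖ ^ 2 = K⁻¹ ^ 2 * ‖q‖ ^ 2 := by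
      rw [norm_neg, norm_smul, mul_pow]; simp
    rw [n1, inner_sub_right, inner_smul_right] at h1
    rw [n2, inner_neg_right, inner_smul_right, inner_add_left, inner_add_left, inner_smul_left,
      real_inner_self_eq_norm_sq, real_inner_comm q (u - v)] at h2
    simp only [RCLike.conj_to_real] at h2
    have hKi : K * K⁻¹ ^ 2 = K⁻¹ := by field_simp
    have h3 : (m + K) / 2 * (K⁻¹ ^ 2 * ‖q‖ ^ 2) =
        m / 2 * (K⁻¹ ^ 2 * ‖q‖ ^ 2) + K⁻¹ / 2 * ‖q‖ ^ 2 := by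
      linear_combination (1 / 2 * ‖q‖ ^ 2) * hKi
    have h4 : 1 / (2 * K) = K⁻¹ / 2 := by field_simp
    rw [h4]
    rw [h3] at h2
    linarith
  have h1 := key u v
  have h2 := key v u
  have e : g v - g u - m • (v - u) = -(g u - g v - m • (u - v)) := by module
  rw [e, norm_neg, norm_sub_rev v u, ← neg_sub u v, inner_neg_right] at h2
  set q := g u - g v - m • (u - v) with hq
  have e2 : inner ℝ q (u - v) =
      inner ℝ (g u) (u - v) - inner ℝ (g v) (u - v) - m * ‖u - v‖ ^ 2 := by
    rw [hq, inner_sub_left, inner_sub_left, inner_smul_left, real_inner_self_eq_norm_sq]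
    simp
  have h3 : 1 / K * ‖q‖ ^ 2 ≤ inner ℝ q (u - v) := by
    rw [e2]
    have : 1 / K * ‖q‖ ^ 2 = 2 * (1 / (2 * K) * ‖q‖ ^ 2) := by field_simp
    linarith
  rw [one_div, inv_mul_le_iff₀ hK] at h3
  exact h3

variable [CompleteSpace E]

lemma hasDerivAt_comp_line {f : E → ℝ} (hf : Differentiable ℝ f) (u d : E) (t : ℝ) :
    HasDerivAt (fun s : ℝ => f (u + s • d)) (inner ℝ (gradient f (u + t • d)) d) t := by
  have h1 : HasDerivAt (fun s : ℝ => u + s • d) d t := by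
    simpa using ((hasDerivAt_id t).smul_const d).const_add u
  have h2 := (hf (u + t • d)).hasGradientAt.hasFDerivAt.comp_hasDerivAt t h1
  simpa [Function.comp_def] using h2

/-- The descent lemma: a function with `M`-Lipschitz gradient lies below the quadratic with
curvature `M` that touches it at `u`. -/
lemma le_quadratic_of_lipschitz_gradient {f : E → ℝ} (hf : Differentiable ℝ f) {M : ℝ}
    (hM : ∀ u v, ‖gradient f u - gradient f v‖ ≤ M * ‖u - v‖) (u d : E) :
    f (u + d) ≤ f u + inner ℝ (gradient f u) d + M / 2 * ‖d‖ ^ 2 := by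
  set φ : ℝ → ℝ := fun s => f (u + s • d) - s * inner ℝ (gradient f u) d - M / 2 * ‖d‖ ^ 2 * s ^ 2
    with hφ
  have hder : ∀ t, HasDerivAt φ (inner ℝ (gradient f (u + t • d)) d - inner ℝ (gradient f u) d -
      M * ‖d‖ ^ 2 * t) t := by
    intro t
    have h := ((hasDerivAt_comp_line hf u d t).sub
      ((hasDerivAt_id t).mul_const (inner ℝ (gradient f u) d))).sub
      (((hasDerivAt_id t).pow 2).const_mul (M / 2 * ‖d‖ ^ 2))
    exact h.congr_deriv (by simp; ring)
  have hanti : AntitoneOn φ (Set.Icc 0 1) := by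
    apply antitoneOn_of_deriv_nonpos (convex_Icc 0 1)
      (fun t _ => (hder t).continuousAt.continuousWithinAt)
      (fun t _ => (hder t).differentiableAt.differentiableWithinAt)
    intro t ht
    rw [interior_Icc] at ht
    rw [(hder t).deriv, ← inner_sub_left]
    have h1 := real_inner_le_norm (gradient f (u + t • d) - gradient f u) d
    have h2 := hM (u + t • d) u
    rw [add_sub_cancel_left, norm_smul, Real.norm_eq_abs, abs_of_pos ht.1] at h2
    nlinarith [norm_nonneg d]
  have := hanti (Set.left_mem_Icc.2 zero_le_one) (Set.right_mem_Icc.2 zero_le_one) zero_le_one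
  simp only [hφ, one_smul, zero_smul, add_zero] at this
  linarith

/-- A strongly convex function lies above the quadratic with curvature `m` that touches it. -/
lemma quadratic_le_of_strongConvexOn {f : E → ℝ} (hf : Differentiable ℝ f) {m : ℝ}
    (hm : StrongConvexOn Set.univ m f) (u d : E) :
    f u + inner ℝ (gradient f u) d + m / 2 * ‖d‖ ^ 2 ≤ f (u + d) := by
  -- Let `t → 0` in the strong convexity inequality between `u` and `u + d`.
  have hseg : ∀ t ∈ Set.Ioo (0 : ℝ) 1,
      t⁻¹ * (f (u + t • d) - f u) ≤ f (u + d) - f u - (1 - t) * (m / 2 * ‖d‖ ^ 2) := by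
    intro t ht
    have h := hm.2 (Set.mem_univ u) (Set.mem_univ (u + d)) (by linarith [ht.2] : (0:ℝ) ≤ 1 - t)
      ht.1.le (by ring)
    have e : (1 - t) • u + t • (u + d) = u + t • d := by module
    rw [e] at h
    simp only [smul_eq_mul, sub_add_cancel_left, norm_neg] at h
    rw [inv_mul_le_iff₀ ht.1]
    nlinarith
  have hlim := (hasDerivAt_comp_line hf u d 0).tendsto_slope_zero_right
  have hlim2 : Filter.Tendsto (fun t : ℝ => f (u + d) - f u - (1 - t) * (m / 2 * ‖d‖ ^ 2))
      (nhdsWithin 0 (Set.Ioi 0)) (nhds (f (u + d) - f u - (1 - 0) * (m / 2 * ‖d‖ ^ 2))) := by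
    apply Filter.Tendsto.mono_left _ nhdsWithin_le_nhds
    apply Continuous.tendsto
    fun_prop
  have := le_of_tendsto_of_tendsto hlim hlim2 (by
    filter_upwards [Ioo_mem_nhdsGT (zero_lt_one' ℝ)] with t ht
    simpa using hseg t ht)
  rw [zero_smul, add_zero] at this
  linarith

/-- A gradient step for an `m`-strongly convex function with `M`-Lipschitz gradient is Lipschitz
with constant `max |1 - α m| |1 - α M|`. -/
lemma norm_gradientStep_sub_le {f : E → ℝ} (hf : Differentiable ℝ f) {m M α : ℝ}
    (hm : StrongConvexOn Set.univ m f)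
    (hM : ∀ u v, ‖gradient f u - gradient f v‖ ≤ M * ‖u - v‖) (hmM : m ≤ M) (hα : 0 < α)
    (u v : E) :
    ‖(u - α • gradient f u) - (v - α • gradient f v)‖ ≤ zeta α m M * ‖u - v‖ := by
  set q := gradient f u - gradient f v - m • (u - v) with hq
  have hco : ‖q‖ ^ 2 ≤ (M - m) * inner ℝ q (u - v) := by
    -- The case `M = m` is reached as a limit.
    have hall : ∀ K : ℝ, M - m < K → ‖q‖ ^ 2 ≤ K * inner ℝ q (u - v) := by
      intro K hK
      refine norm_sq_le_mul_inner_of_quadratic_bounds (f := f) (by linarith)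
        (quadratic_le_of_strongConvexOn hf hm) (fun u d => ?_) u v
      refine (le_quadratic_of_lipschitz_gradient hf hM u d).trans ?_
      have : 0 ≤ ‖d‖ ^ 2 := by positivity
      nlinarith
    have hlim : Filter.Tendsto (fun K : ℝ => K * inner ℝ q (u - v))
        (nhdsWithin (M - m) (Set.Ioi (M - m))) (nhds ((M - m) * inner ℝ q (u - v))) := by
      apply Filter.Tendsto.mono_left _ nhdsWithin_le_nhds
      apply Continuous.tendsto
      fun_prop
    exact ge_of_tendsto hlim (by
      filter_upwards [self_mem_nhdsWithin] with K hK using hall K hK)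
  set d := u - v with hd
  have e : (u - α • gradient f u) - (v - α • gradient f v) = (1 - α * m) • d - α • q := by
    rw [hq, hd]; module
  have hz0 : 0 ≤ zeta α m M := (abs_nonneg _).trans (le_max_left _ _)
  have hz1 : (1 - α * m) ^ 2 ≤ zeta α m M ^ 2 := by
    rw [← sq_abs]; gcongr; exact le_max_left _ _
  have hz2 : (1 - α * M) ^ 2 ≤ zeta α m M ^ 2 := by
    rw [← sq_abs]; gcongr; exact le_max_right _ _
  rw [e]
  apply abs_le_of_sq_le_sq' _ (by positivity) |>.2
  have hn : ‖(1 - α * m) • d - α • q‖ ^ 2 =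
      (1 - α * m) ^ 2 * ‖d‖ ^ 2 - 2 * α * (1 - α * m) * inner ℝ q d + α ^ 2 * ‖q‖ ^ 2 := by
    rw [norm_sub_sq_real, norm_smul, norm_smul, mul_pow, mul_pow, inner_smul_left,
      inner_smul_right, real_inner_comm]
    simp only [Real.norm_eq_abs, sq_abs, RCLike.conj_to_real]
    ring
  have hcs := real_inner_le_norm q d
  set s := inner ℝ q d with hs
  have hs0 : 0 ≤ s := by
    by_contra! hneg
    have h0 : ‖q‖ ^ 2 ≤ 0 := hco.trans (mul_nonpos_of_nonneg_of_nonpos (by linarith) hneg.le)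
    have h1 : ‖q‖ = 0 := by nlinarith [norm_nonneg q]
    have h2 : q = 0 := norm_eq_zero.1 h1
    rw [hs, h2, inner_zero_left] at hneg
    exact lt_irrefl _ hneg
  have hsd : s ≤ (M - m) * ‖d‖ ^ 2 := by
    have h1 : ‖q‖ * ‖q‖ ≤ (M - m) * ‖d‖ * ‖q‖ := by nlinarith
    rcases (norm_nonneg q).eq_or_lt with h0 | h0
    · rw [← h0, zero_mul] at hcs
      exact hcs.trans (mul_nonneg (by linarith) (by positivity))
    · have := le_of_mul_le_mul_right h1 h0
      nlinarith [norm_nonneg d]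
  have hα2 : α ^ 2 * ‖q‖ ^ 2 ≤ α ^ 2 * ((M - m) * s) := by gcongr
  rw [hn, mul_pow]
  have hd2 : 0 ≤ ‖d‖ ^ 2 := by positivity
  rcases le_total (α * (M + m)) 2 with h | h
  · have h1 : 0 ≤ α * s * (2 - α * (M + m)) := by
      apply mul_nonneg (by positivity); linarith
    nlinarith
  · have h1 : s * (α * (α * (M + m) - 2)) ≤ (M - m) * ‖d‖ ^ 2 * (α * (α * (M + m) - 2)) := by
      apply mul_le_mul_of_nonneg_right hsd
      apply mul_nonneg hα.le; linarith
    nlinarith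

lemma le_of_strongConvex_of_lipschitz_gradient [Nontrivial E] {f : E → ℝ}
    (hf : Differentiable ℝ f) {m M : ℝ} (hm : StrongConvexOn Set.univ m f)
    (hM : ∀ u v, ‖gradient f u - gradient f v‖ ≤ M * ‖u - v‖) : m ≤ M := by
  obtain ⟨d, hd⟩ := exists_ne (0 : E)
  have h1 := quadratic_le_of_strongConvexOn hf hm 0 d
  have h2 := le_quadratic_of_lipschitz_gradient hf hM 0 d
  have h3 : 0 < ‖d‖ ^ 2 := by positivity
  by_contra! h
  nlinarith

/-- First-order optimality for a sum of differentiable functions. -/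
lemma sum_gradient_eq_zero {ι : Type*} [Fintype ι] {f : ι → E → ℝ}
    (hf : ∀ i, Differentiable ℝ (f i)) {u : E} (hu : IsMinOn (fun v => ∑ i, f i v) Set.univ u) :
    ∑ i, gradient (f i) u = 0 := by
  have h1 : HasFDerivAt (fun v => ∑ i, f i v)
      (∑ i, InnerProductSpace.toDual ℝ E (gradient (f i) u)) u :=
    HasFDerivAt.fun_sum fun i _ => (hf i u).hasGradientAt.hasFDerivAt
  have h2 := (hu.isLocalMin Filter.univ_mem).hasFDerivAt_eq_zero h1
  rw [← map_sum] at h2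
  exact (InnerProductSpace.toDual ℝ E).map_eq_zero_iff.1 h2

end GradientStep

lemma zeta_lt_one {α m M : ℝ} (hm : 0 < m) (hmM : m ≤ M) (hα : 0 < α) (hαM : α < 2 / M) :
    zeta α m M < 1 := by
  have hM : 0 < M := by linarith
  rw [lt_div_iff₀ hM] at hαM
  have h1 : α * m ≤ α * M := by gcongr
  have h2 : 0 < α * m := by positivity
  rw [zeta, max_lt_iff, abs_lt, abs_lt]
  refine ⟨⟨?_, ?_⟩, ?_, ?_⟩ <;> linarith

/-! ### Accuracy of quantized coordination -/

section Coordination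

variable {V : Type*} {G : SimpleGraph V} {n : ℕ}

/-- The `j`-th components of all auxiliary variables. -/
noncomputable def slice (z : EdgeVec G n) (j : Fin n) : EuclideanSpace ℝ G.Dart :=
  WithLp.toLp 2 fun d => z d j

lemma slice_sub (z z' : EdgeVec G n) (j : Fin n) : slice (z - z') j = slice z j - slice z' j := rfl

variable [Fintype V] [DecidableRel G.Adj]

lemma sq_quantError {Δ : ℝ} : quantError G n Δ ^ 2 =
    Fintype.card G.Dart * (n * (Δ / 2) ^ 2) := by
  rw [quantError, mul_pow, Real.sq_sqrt (by positivity), G.dart_card_eq_sum_degrees]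
  push_cast
  ring

lemma quantError_nonneg {Δ : ℝ} (hΔ : 0 < Δ) : 0 ≤ quantError G n Δ := by
  unfold quantError; positivity

variable [DecidableEq V]

lemma localUpdate_apply (ρ : ℝ) (y : V → Vec n) (z : EdgeVec G n) (i : V) (j : Fin n) :
    localUpdate G ρ y z i j = scalarUpdate G ρ (fun i => y i j) (slice z j) i := by
  simp [localUpdate, scalarUpdate, slice, mul_add]

lemma scalarUpdate_sub (ρ : ℝ) (y : V → ℝ) (v v' : EuclideanSpace ℝ G.Dart) (i : V) :
    scalarUpdate G ρ y v i - scalarUpdate G ρ y v' i = scalarUpdate G ρ 0 (v - v') i := by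
  simp only [scalarUpdate, PiLp.sub_apply, Finset.sum_sub_distrib, Pi.zero_apply]
  ring

lemma admmStep_id_apply (ρ : ℝ) (y : V → Vec n) (z : EdgeVec G n) (d : G.Dart) (j : Fin n) :
    admmStep G ρ id y z d j = 1 / 2 * (z d j +
      (-z d.symm j + 2 * ρ * scalarUpdate G ρ (fun i => y i j) (slice z j) d.snd)) := by
  simp only [admmStep, message, id, ← localUpdate_apply]
  simp only [PiLp.smul_apply, PiLp.add_apply, PiLp.neg_apply, smul_eq_mul]
  rfl

lemma slice_admmStep_sub (ρ : ℝ) (y : V → Vec n) (z z' : EdgeVec G n) (j : Fin n) :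
    slice (admmStep G ρ id y z - admmStep G ρ id y z') j =
      (1 / 2 : ℝ) • (slice (z - z') j + reflection G ρ (slice (z - z') j)) := by
  ext d
  rw [slice_sub, slice_sub]
  simp only [PiLp.sub_apply, PiLp.smul_apply, PiLp.add_apply, reflection_apply, smul_eq_mul,
    ← scalarUpdate_sub ρ (fun i => y i j)]
  have e : ∀ z : EdgeVec G n, slice z j d = z d j := fun _ => rfl
  have e' : ∀ z : EdgeVec G n, slice z j d.symm = z d.symm j := fun _ => rfl
  simp only [e, e', admmStep_id_apply]
  ring

lemma admmStep_eq_self_iff (ρ : ℝ) (y : V → Vec n) (z : EdgeVec G n) :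
    admmStep G ρ id y z = z ↔ ∀ j (d : G.Dart), slice z j d + slice z j d.symm =
      2 * ρ * scalarUpdate G ρ (fun i => y i j) (slice z j) d.snd := by
  have e : ∀ j d, slice z j d = z d j := fun _ _ => rfl
  constructor
  · intro h j d
    have h1 := admmStep_id_apply ρ y z d j
    rw [h] at h1
    rw [e, e]
    linarith
  · intro h
    ext d j
    have h1 := h j d
    rw [e, e] at h1
    rw [admmStep_id_apply]
    linarith

lemma exists_admmStep_eq_self (hG : G.Connected) {ρ : ℝ} (hρ : 0 < ρ) (y : V → Vec n) :
    ∃ z : EdgeVec G n, admmStep G ρ id y z = z := by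
  choose v hv using fun j : Fin n => exists_scalar_fixedPoint hG hρ (fun i => y i j)
  refine ⟨WithLp.toLp 2 fun d => WithLp.toLp 2 fun j => v j d, ?_⟩
  rw [admmStep_eq_self_iff]
  exact fun j d => hv j d

/-- The part of the auxiliary variables that the unquantized scheme contracts: in every component
of the local states, the part orthogonal to the fixed points of `reflection`. -/
noncomputable def perpPart (ρ : ℝ) :
    EdgeVec G n →ₗ[ℝ] PiLp 2 (fun _ : Fin n => EuclideanSpace ℝ G.Dart) where
  toFun z := WithLp.toLp 2 fun j => fixPerp (reflection G ρ) (slice z j)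
  map_add' z z' := by
    ext1 j
    exact map_add (fixPerp (reflection G ρ)) (slice z j) (slice z' j)
  map_smul' a z := by
    ext1 j
    exact map_smul (fixPerp (reflection G ρ)) a (slice z j)

lemma perpPart_apply (ρ : ℝ) (z : EdgeVec G n) (j : Fin n) :
    perpPart ρ z j = fixPerp (reflection G ρ) (slice z j) := rfl

lemma norm_perpPart_le (ρ : ℝ) (z : EdgeVec G n) : ‖perpPart ρ z‖ ≤ ‖z‖ := by
  apply abs_le_of_sq_le_sq' _ (norm_nonneg _) |>.2
  rw [PiLp.norm_sq_eq_of_L2, PiLp.norm_sq_eq_of_L2]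
  calc ∑ j, ‖perpPart ρ z j‖ ^ 2 ≤ ∑ j, ‖slice z j‖ ^ 2 := by
        refine Finset.sum_le_sum fun j _ => ?_
        rw [perpPart_apply]
        gcongr
        exact norm_fixPerp_le _ _
    _ = ∑ j, ∑ d, ‖z d j‖ ^ 2 := by simp only [EuclideanSpace.norm_sq_eq]; rfl
    _ = ∑ d, ‖z d‖ ^ 2 := by
        rw [Finset.sum_comm]
        simp only [EuclideanSpace.norm_sq_eq]

lemma perpPart_sub_eq_zero (ρ : ℝ) (y : V → Vec n) {z z' : EdgeVec G n}
    (hz : admmStep G ρ id y z = z) (hz' : admmStep G ρ id y z' = z') :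
    perpPart ρ (z - z') = 0 := by
  ext1 j
  refine fixPerp_eq_zero _ ?_
  ext d
  have h1 := (admmStep_eq_self_iff ρ y z).1 hz j d
  have h2 := (admmStep_eq_self_iff ρ y z').1 hz' j d
  have h3 := scalarUpdate_sub ρ (fun i => y i j) (slice z j) (slice z' j) d.snd
  rw [reflection_apply, slice_sub, ← h3]
  simp only [PiLp.sub_apply]
  linarith

lemma norm_perpPart_sub_le_fixDist (hG : G.Connected) {ρ : ℝ} (hρ : 0 < ρ) (y : V → Vec n)
    (z : EdgeVec G n) {zb : EdgeVec G n} (hzb : admmStep G ρ id y zb = zb) :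
    ‖perpPart ρ (z - zb)‖ ≤ fixDist G ρ y z := by
  have hne : {z' : EdgeVec G n | admmStep G ρ id y z' = z'}.Nonempty :=
    exists_admmStep_eq_self hG hρ y
  rw [fixDist, Metric.le_infDist hne]
  intro z' hz'
  have h : perpPart ρ (z - zb) = perpPart ρ (z - z') := by
    rw [← sub_add_sub_cancel z z' zb, map_add, perpPart_sub_eq_zero ρ y hz' hzb, add_zero]
  rw [h, dist_eq_norm]
  exact norm_perpPart_le _ _

/-- Local states differ from the average of `y` by at most the contracted part of the auxiliary
variables, up to a constant depending on the graph only. -/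
lemma norm_localUpdate_sub_mean_le (hG : G.Connected) {ρ : ℝ} (hρ : 0 < ρ) (y : V → Vec n)
    (z : EdgeVec G n) {zb : EdgeVec G n} (hzb : admmStep G ρ id y zb = zb) (i : V) :
    ‖localUpdate G ρ y z i - (Fintype.card V : ℝ)⁻¹ • ∑ j, y j‖ ≤
      √(Fintype.card G.Dart) * ‖perpPart ρ (z - zb)‖ := by
  have hlin : ∀ v : EuclideanSpace ℝ G.Dart,
      |scalarUpdate G ρ 0 v i| ≤ √(Fintype.card G.Dart) * ‖v‖ := by
    intro v
    have h1 : (1 : ℝ) ≤ 1 + ρ * G.degree i := le_add_of_nonneg_right (by positivity)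
    rw [scalarUpdate, abs_mul, abs_of_pos (by positivity), Pi.zero_apply, zero_add]
    refine (mul_le_of_le_one_left (abs_nonneg _) (inv_le_one_of_one_le₀ h1)).trans ?_
    rw [← Real.sqrt_sq (norm_nonneg v), ← Real.sqrt_mul (by positivity)]
    apply Real.abs_le_sqrt
    calc (∑ d : G.Dart with d.fst = i, v d) ^ 2
        ≤ ({d : G.Dart | d.fst = i} : Finset G.Dart).card * ∑ d : G.Dart with d.fst = i, v d ^ 2 :=
          sq_sum_le_card_mul_sum_sq
      _ ≤ Fintype.card G.Dart * ∑ d, v d ^ 2 := by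
          gcongr
          · exact Finset.card_le_univ _
          · exact Finset.subset_univ _
      _ = Fintype.card G.Dart * ‖v‖ ^ 2 := by simp [EuclideanSpace.norm_sq_eq]
  have hcoord : ∀ j, |(localUpdate G ρ y z i - (Fintype.card V : ℝ)⁻¹ • ∑ k, y k) j| ≤
      √(Fintype.card G.Dart) * ‖perpPart ρ (z - zb) j‖ := by
    intro j
    have hfix := (admmStep_eq_self_iff ρ y zb).1 hzb j
    have hmean := scalarUpdate_eq_mean hG hρ _ _ hfix i
    set s := slice (z - zb) j with hs
    have h0 := apply_sub_fixPerp (reflection G ρ) s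
    have h1 := scalarUpdate_eq_zero hG hρ h0 i
    have h2 : scalarUpdate G ρ 0 (fixPerp (reflection G ρ) s) i = scalarUpdate G ρ 0 s i := by
      rw [← sub_eq_zero, ← neg_eq_zero, neg_sub, scalarUpdate_sub, h1]
    have h3 : (localUpdate G ρ y z i - (Fintype.card V : ℝ)⁻¹ • ∑ k, y k) j =
        scalarUpdate G ρ 0 (fixPerp (reflection G ρ) s) i := by
      rw [h2, hs, slice_sub, ← scalarUpdate_sub ρ (fun i => y i j), hmean, ← localUpdate_apply]
      simp
    rw [h3, perpPart_apply]
    exact hlin _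
  apply abs_le_of_sq_le_sq' _ (by positivity) |>.2
  rw [mul_pow, EuclideanSpace.norm_sq_eq, PiLp.norm_sq_eq_of_L2, Finset.mul_sum]
  refine Finset.sum_le_sum fun j _ => ?_
  rw [← mul_pow, Real.norm_eq_abs]
  gcongr
  exact hcoord j

lemma norm_quantize_sub_le {Δ : ℝ} (hΔ : 0 < Δ) (v : Vec n) :
    ‖quantize Δ v - v‖ ^ 2 ≤ n * (Δ / 2) ^ 2 := by
  rw [EuclideanSpace.norm_sq_eq]
  calc _ ≤ ∑ _j : Fin n, (Δ / 2) ^ 2 := by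
        refine Finset.sum_le_sum fun j _ => ?_
        gcongr
        have h := abs_sub_round (v j / Δ)
        have e : (quantize Δ v - v) j = -(Δ * (v j / Δ - round (v j / Δ))) := by
          simp only [quantize, PiLp.sub_apply]; field_simp; ring
        rw [e, norm_neg, Real.norm_eq_abs, abs_mul, abs_of_pos hΔ]
        nlinarith
    _ = _ := by simp

/-- One round with quantized messages differs from one round with exact messages by at most
`quantError`. -/
lemma norm_admmStep_quantize_sub_le (ρ : ℝ) {Δ : ℝ} (hΔ : 0 < Δ) (y : V → Vec n)
    (z : EdgeVec G n) :
    ‖admmStep G ρ (quantize Δ) y z - admmStep G ρ id y z‖ ≤ quantError G n Δ := by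
  apply abs_le_of_sq_le_sq' _ (quantError_nonneg hΔ) |>.2
  rw [sq_quantError, PiLp.norm_sq_eq_of_L2]
  calc _ ≤ ∑ _d : G.Dart, (n * (Δ / 2) ^ 2 : ℝ) := by
        refine Finset.sum_le_sum fun d _ => ?_
        set t := -(z d.symm) + (2 * ρ) • localUpdate G ρ y z d.symm.fst with ht
        have e : (admmStep G ρ (quantize Δ) y z - admmStep G ρ id y z) d =
            (1 / 2 : ℝ) • (quantize Δ t - t) := by
          simp only [admmStep, message, PiLp.sub_apply, id, ← ht]
          module
        rw [e, norm_smul, mul_pow]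
        refine le_trans ?_ (norm_quantize_sub_le hΔ t)
        apply mul_le_of_le_one_left (by positivity)
        norm_num
    _ = _ := by simp

/-- `μ` is a rate at which a round of the unquantized scheme contracts the component orthogonal to
its fixed directions, for scalar local variables. -/
structure IsContractionRate (G : SimpleGraph V) [DecidableRel G.Adj] (ρ μ : ℝ) : Prop where
  pos : 0 < μ
  lt_one : μ < 1
  contracts : ∀ v : EuclideanSpace ℝ G.Dart,
    ‖fixPerp (reflection G ρ) ((1 / 2 : ℝ) • (v + reflection G ρ v))‖ ≤
      μ * ‖fixPerp (reflection G ρ) v‖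

lemma exists_isContractionRate {ρ : ℝ} (hρ : 0 < ρ) : ∃ μ, IsContractionRate G ρ μ := by
  obtain ⟨μ, h0, h1, h2⟩ := exists_contraction_fixPerp (reflection G ρ) (norm_reflection_le hρ)
  exact ⟨μ, h0, h1, h2⟩

section Iteration

variable {ρ Δ μ : ℝ}

lemma norm_perpPart_admmStep_sub_le (hμ : IsContractionRate G ρ μ) (y : V → Vec n)
    (z z' : EdgeVec G n) :
    ‖perpPart ρ (admmStep G ρ id y z - admmStep G ρ id y z')‖ ≤ μ * ‖perpPart ρ (z - z')‖ := by
  have hpos := hμ.pos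
  apply abs_le_of_sq_le_sq' _ (by positivity) |>.2
  rw [mul_pow, PiLp.norm_sq_eq_of_L2, PiLp.norm_sq_eq_of_L2, Finset.mul_sum]
  refine Finset.sum_le_sum fun j _ => ?_
  rw [← mul_pow, perpPart_apply, perpPart_apply, slice_admmStep_sub]
  gcongr
  exact hμ.contracts _

lemma norm_perpPart_zIter_succ_le (hμ : IsContractionRate G ρ μ) (hΔ : 0 < Δ) (y : V → Vec n)
    (z₀ : EdgeVec G n) {zb : EdgeVec G n} (hzb : admmStep G ρ id y zb = zb) (l : ℕ) :
    ‖perpPart ρ (zIter G ρ Δ y z₀ (l + 1) - zb)‖ ≤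
      μ * ‖perpPart ρ (zIter G ρ Δ y z₀ l - zb)‖ + quantError G n Δ := by
  set z := zIter G ρ Δ y z₀ l with hz
  have e : zIter G ρ Δ y z₀ (l + 1) = admmStep G ρ (quantize Δ) y z := by
    rw [hz, zIter, zIter, Function.iterate_succ_apply']
  have e2 : admmStep G ρ (quantize Δ) y z - zb =
      (admmStep G ρ id y z - admmStep G ρ id y zb) +
        (admmStep G ρ (quantize Δ) y z - admmStep G ρ id y z) := by
    rw [hzb]; abel
  rw [e, e2, map_add]
  refine (norm_add_le _ _).trans (add_le_add (norm_perpPart_admmStep_sub_le hμ y z zb) ?_)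
  exact (norm_perpPart_le _ _).trans (norm_admmStep_quantize_sub_le ρ hΔ y z)

lemma norm_perpPart_zIter_add_le (hμ : IsContractionRate G ρ μ) (hΔ : 0 < Δ) (y : V → Vec n)
    (z₀ : EdgeVec G n) {zb : EdgeVec G n} (hzb : admmStep G ρ id y zb = zb) (m l : ℕ) :
    ‖perpPart ρ (zIter G ρ Δ y z₀ (m + l) - zb)‖ ≤
      μ ^ l * ‖perpPart ρ (zIter G ρ Δ y z₀ m - zb)‖ + quantError G n Δ / (1 - μ) := by
  have h1 : 0 < 1 - μ := sub_pos.2 hμ.lt_one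
  have hE := quantError_nonneg (G := G) (n := n) hΔ
  induction l with
  | zero =>
    have : 0 ≤ quantError G n Δ / (1 - μ) := by positivity
    simp [this]
  | succ l ih =>
    refine (norm_perpPart_zIter_succ_le hμ hΔ y z₀ hzb (m + l)).trans ?_
    have h2 := mul_le_mul_of_nonneg_left ih hμ.pos.le
    have h3 : μ * (quantError G n Δ / (1 - μ)) + quantError G n Δ =
        quantError G n Δ / (1 - μ) := by field_simp; ring
    rw [pow_succ]
    nlinarith

/-- Both ways of leaving the coordination scheme leave an error of the order of `quantError`. -/
lemma norm_perpPart_le_of_mayStop (hμ : IsContractionRate G ρ μ) (hG : G.Connected)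
    (hρ : 0 < ρ) (hn : 0 < n) (hΔ : 0 < Δ) {c : ℝ} (hc : 0 < c) (y : V → Vec n)
    (z₀ : EdgeVec G n) {zb : EdgeVec G n}
    (hzb : admmStep G ρ id y zb = zb) {l : ℕ} (hl : MayStop G ρ Δ (c * Δ) μ y z₀ l) :
    ‖perpPart ρ (zIter G ρ Δ y z₀ l - zb)‖ ≤ (2 * c + 2) * (quantError G n Δ / (1 - μ)) := by
  have h1 : 0 < 1 - μ := sub_pos.2 hμ.lt_one
  have hE := quantError_nonneg (G := G) (n := n) hΔ
  have hE1 : 0 ≤ quantError G n Δ / (1 - μ) := by positivity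
  rcases hl with ⟨m, hml, hm⟩ | hl
  · obtain ⟨k, rfl⟩ := Nat.exists_eq_add_of_le hml
    set z := zIter G ρ Δ y z₀ m with hz
    -- A small step forces a small distance, since exact rounds contract by `μ < 1`.
    have hstep : ‖zIter G ρ Δ y z₀ (m + 1) - z‖ ≤ 2 * c * quantError G n Δ := by
      apply abs_le_of_sq_le_sq' _ (by positivity) |>.2
      rw [mul_pow, sq_quantError, PiLp.norm_sq_eq_of_L2]
      calc _ ≤ ∑ _d : G.Dart, (c * Δ) ^ 2 := by
            refine Finset.sum_le_sum fun d _ => ?_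
            gcongr
            exact hm d
        _ = Fintype.card G.Dart * (c * Δ) ^ 2 := by simp
        _ ≤ Fintype.card G.Dart * (n * (c * Δ) ^ 2) := by
            gcongr
            exact le_mul_of_one_le_left (by positivity) (by exact_mod_cast hn)
        _ = _ := by ring
    have h2 := norm_perpPart_zIter_succ_le hμ hΔ y z₀ hzb m
    have h3 : ‖perpPart ρ (z - zb)‖ ≤ ‖perpPart ρ (zIter G ρ Δ y z₀ (m + 1) - zb)‖ +
        2 * c * quantError G n Δ := by
      have e : z - zb = (zIter G ρ Δ y z₀ (m + 1) - zb) - (zIter G ρ Δ y z₀ (m + 1) - z) := by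
        abel
      rw [e, map_sub]
      exact (norm_sub_le _ _).trans (by
        gcongr; exact (norm_perpPart_le _ _).trans hstep)
    rw [← hz] at h2
    have h4 : ‖perpPart ρ (z - zb)‖ ≤ (2 * c + 1) * (quantError G n Δ / (1 - μ)) := by
      rw [← mul_div_assoc, le_div_iff₀ h1]
      linarith
    have h5 := norm_perpPart_zIter_add_le hμ hΔ y z₀ hzb m k
    have h6 : μ ^ k * ‖perpPart ρ (z - zb)‖ ≤ ‖perpPart ρ (z - zb)‖ :=
      mul_le_of_le_one_left (norm_nonneg _) (pow_le_one₀ hμ.pos.le hμ.lt_one.le)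
    rw [← hz] at h5
    linarith
  · have h5 := norm_perpPart_zIter_add_le hμ hΔ y z₀ hzb 0 l
    rw [zero_add] at h5
    have h0 : ‖perpPart ρ (zIter G ρ Δ y z₀ 0 - zb)‖ ≤ fixDist G ρ y z₀ :=
      norm_perpPart_sub_le_fixDist hG hρ y z₀ hzb
    suffices h6 : μ ^ l * ‖perpPart ρ (zIter G ρ Δ y z₀ 0 - zb)‖ ≤
        quantError G n Δ / (1 - μ) by nlinarith
    set d₀ := fixDist G ρ y z₀ with hd₀
    rcases hE.eq_or_lt with hE0 | hEpos
    · -- Without edges there are no auxiliary variables.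
      have hcard : Fintype.card G.Dart = 0 := by
        have h := sq_quantError (G := G) (n := n) (Δ := Δ)
        rw [← hE0] at h
        have hn' : (0 : ℝ) < n := by exact_mod_cast hn
        have : (0 : ℝ) < n * (Δ / 2) ^ 2 := by positivity
        by_contra hne
        have : (0 : ℝ) < Fintype.card G.Dart := by exact_mod_cast Nat.pos_of_ne_zero hne
        have : (0 : ℝ) < Fintype.card G.Dart * (n * (Δ / 2) ^ 2) := by positivity
        linarith
      have := Fintype.card_eq_zero_iff.1 hcard
      have hz : zIter G ρ Δ y z₀ 0 - zb = 0 := Subsingleton.elim _ _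
      rw [hz, map_zero, norm_zero, mul_zero]
      exact hE1
    · rcases ((norm_nonneg _).trans h0).eq_or_lt with hd | hd
      · have : ‖perpPart ρ (zIter G ρ Δ y z₀ 0 - zb)‖ = 0 :=
          le_antisymm (by rw [hd]; exact h0) (norm_nonneg _)
        rw [this, mul_zero]
        exact hE1
      · have hpos := hμ.pos
        have hlog : Real.log μ < 0 := Real.log_neg hμ.pos hμ.lt_one
        set r := quantError G n Δ / ((1 - μ) * d₀) with hr
        have hrpos : 0 < r := by positivity
        have h7 : Real.log r / Real.log μ ≤ l := by
          refine le_trans ?_ ((le_abs_self _).trans hl)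
          rw [← hd₀, ← hr, one_div, inv_mul_eq_div]
        have h8 : μ ^ l ≤ r := by
          rw [← Real.log_le_log_iff (by positivity) hrpos, Real.log_pow]
          rwa [div_le_iff_of_neg hlog] at h7
        calc μ ^ l * ‖perpPart ρ (zIter G ρ Δ y z₀ 0 - zb)‖ ≤ r * d₀ := by gcongr
          _ = quantError G n Δ / (1 - μ) := by rw [hr]; field_simp

end Iteration

/-- Accuracy of the quantized coordination scheme: every local state that may be returned is close
to the average of `y`. The constants depend on the graph, `ρ` and `c` only. -/
theorem exists_coordination_bound (hG : G.Connected) {ρ : ℝ} (hρ : 0 < ρ) {c : ℝ} (hc : 0 < c) :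
    ∃ μ C : ℝ, 0 < μ ∧ μ < 1 ∧ 0 < C ∧ ∀ (n : ℕ) (_ : 0 < n) (Δ : ℝ) (_ : 0 < Δ)
      (y : V → Vec n) (z₀ : EdgeVec G n) (l : ℕ) (_ : MayStop G ρ Δ (c * Δ) μ y z₀ l) (i : V),
        ‖wIter G ρ Δ y z₀ l i - (Fintype.card V : ℝ)⁻¹ • ∑ j, y j‖ ≤
          C * quantError G n Δ / (1 - μ) := by
  obtain ⟨μ, hμ⟩ := exists_isContractionRate (G := G) hρ
  have h1 : 0 < 1 - μ := sub_pos.2 hμ.lt_one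
  refine ⟨μ, (√(Fintype.card G.Dart) + 1) * (2 * c + 2), hμ.pos, hμ.lt_one, by positivity, ?_⟩
  intro n hn Δ hΔ y z₀ l hl i
  obtain ⟨zb, hzb⟩ := exists_admmStep_eq_self hG hρ y
  have hE := quantError_nonneg (G := G) (n := n) hΔ
  refine (norm_localUpdate_sub_mean_le hG hρ y _ hzb i).trans ?_
  have h2 := norm_perpPart_le_of_mayStop hμ hG hρ hn hΔ hc y z₀ hzb hl
  calc _ ≤ √(Fintype.card G.Dart) * ((2 * c + 2) * (quantError G n Δ / (1 - μ))) := by gcongr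
    _ ≤ (√(Fintype.card G.Dart) + 1) * ((2 * c + 2) * (quantError G n Δ / (1 - μ))) := by
        gcongr; linarith
    _ = _ := by ring

end Coordination

/-! ### Measurability of the scheme -/

section Measurability

variable {V Ω : Type*} [Fintype V] [DecidableEq V] {G : SimpleGraph V} [DecidableRel G.Adj] {n : ℕ}

lemma measurable_quantize (Δ : ℝ) : Measurable (quantize Δ : Vec n → Vec n) := by
  unfold quantize
  have h : Measurable (fun t : ℝ => Δ * (round (t / Δ) : ℝ)) := by
    simp only [round_eq]
    have : Measurable fun t : ℝ => ⌊t / Δ + 1 / 2⌋ := Int.measurable_floor.comp (by fun_prop)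
    have hcast : Measurable fun t : ℝ => ((⌊t / Δ + 1 / 2⌋ : ℤ) : ℝ) :=
      measurable_from_top.comp this
    exact hcast.const_mul Δ
  have h2 : ∀ j, Measurable fun v : Vec n => Δ * (round (v j / Δ) : ℝ) :=
    fun j => h.comp (by fun_prop)
  fun_prop

variable {m : MeasurableSpace Ω} {y : Ω → V → Vec n} {z : Ω → EdgeVec G n}

lemma measurable_localUpdate (ρ : ℝ) (hy : Measurable y) (hz : Measurable z) (i : V) :
    Measurable fun ω => localUpdate G ρ (y ω) (z ω) i := by
  unfold localUpdate
  fun_prop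

lemma measurable_admmStep (ρ : ℝ) {q : Vec n → Vec n} (hq : Measurable q) (hy : Measurable y)
    (hz : Measurable z) : Measurable fun ω => admmStep G ρ q (y ω) (z ω) := by
  have h : ∀ d : G.Dart, Measurable fun ω => message G ρ q (y ω) (z ω) d := by
    intro d
    have := measurable_localUpdate ρ hy hz d.fst
    unfold message
    fun_prop
  unfold admmStep
  fun_prop

lemma measurable_zIter (ρ Δ : ℝ) (hy : Measurable y) (hz : Measurable z) (l : ℕ) :
    Measurable fun ω => zIter G ρ Δ (y ω) (z ω) l := by
  induction l with
  | zero => exact hz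
  | succ l ih =>
    simp only [zIter, Function.iterate_succ_apply'] at ih ⊢
    exact measurable_admmStep ρ (measurable_quantize Δ) hy ih

lemma measurable_wIter (ρ Δ : ℝ) (hy : Measurable y) (hz : Measurable z) {l : Ω → ℕ}
    (hl : Measurable l) (i : V) : Measurable fun ω => wIter G ρ Δ (y ω) (z ω) (l ω) i := by
  have h : Measurable fun p : Ω × ℕ => wIter G ρ Δ (y p.1) (z p.1) p.2 i :=
    measurable_from_prod_countable_left fun l =>
      measurable_localUpdate ρ hy (measurable_zIter ρ Δ hy hz l) i
  exact h.comp (measurable_id.prodMk hl)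

end Measurability

/-! ### Expectations and independence -/

section Expectation

variable {Ω : Type*} {m m0 : MeasurableSpace Ω} {P : Measure Ω}

/-- Integration over an event independent of `m` of an `m`-measurable function. -/
lemma setLIntegral_of_indep (hm : m ≤ m0) {A : Set Ω} {c : ENNReal}
    (hP : ∀ s, MeasurableSet[m] s → P (A ∩ s) = c * P s) {f : Ω → ENNReal} (hf : Measurable[m] f) :
    ∫⁻ ω in A, f ω ∂P = c * ∫⁻ ω, f ω ∂P := by
  have h : (P.restrict A).trim hm = c • P.trim hm := by
    refine @Measure.ext _ m _ _ fun s hs => ?_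
    rw [Measure.smul_apply, trim_measurableSet_eq hm hs, trim_measurableSet_eq hm hs,
      Measure.restrict_apply (hm s hs), Set.inter_comm, hP s hs, smul_eq_mul]
  rw [← lintegral_trim hm hf, h, lintegral_smul_measure, lintegral_trim hm hf, smul_eq_mul]

/-- Expectation of a random choice, independent of the past, between two quantities that are known
from the past. -/
lemma lintegral_indicator_add_le [IsProbabilityMeasure P] (hm : m ≤ m0) {A : Set Ω}
    (hA : MeasurableSet[m0] A) {p : ℝ} (hp0 : 0 ≤ p) (hp1 : p ≤ 1)
    (hP : ∀ s, MeasurableSet[m] s → P (A ∩ s) = ENNReal.ofReal p * P s) {f g : Ω → ENNReal}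
    (hf : Measurable[m] f) (hg : Measurable[m] g) {a b : ℝ} (ha : 0 ≤ a) (hb : 0 ≤ b)
    (hfa : ∫⁻ ω, f ω ∂P ≤ ENNReal.ofReal a) (hgb : ∫⁻ ω, g ω ∂P ≤ ENNReal.ofReal b) :
    ∫⁻ ω, (A.indicator f ω + Aᶜ.indicator g ω) ∂P ≤ ENNReal.ofReal (p * a + (1 - p) * b) := by
  have hPc : ∀ s, MeasurableSet[m] s → P (Aᶜ ∩ s) = ENNReal.ofReal (1 - p) * P s := by
    intro s hs
    have h1 := measure_inter_add_sdiff (μ := P) s hA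
    rw [Set.inter_comm, hP s hs, Set.sdiff_eq, Set.inter_comm s] at h1
    have h2 : ENNReal.ofReal p * P s + ENNReal.ofReal (1 - p) * P s = P s := by
      rw [← add_mul, ← ENNReal.ofReal_add hp0 (by linarith)]
      simp
    have hfin : ENNReal.ofReal p * P s ≠ ⊤ :=
      ENNReal.mul_ne_top ENNReal.ofReal_ne_top (measure_ne_top P s)
    exact (ENNReal.add_right_inj hfin).1 (h1.trans h2.symm)
  rw [lintegral_add_left ((hf.mono hm le_rfl).indicator hA), lintegral_indicator hA,
    lintegral_indicator hA.compl, setLIntegral_of_indep hm hP hf,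
    setLIntegral_of_indep hm hPc hg, ENNReal.ofReal_add (by positivity)
      (mul_nonneg (by linarith) hb), ENNReal.ofReal_mul hp0, ENNReal.ofReal_mul (by linarith)]
  gcongr

/-- An error bound that holds at every fixed point of the state space holds in expectation at a
random point that is independent of the sample. -/
lemma lintegral_comp_le_of_indep [IsProbabilityMeasure P] (hm : m ≤ m0) {E Ξ : Type*}
    [MeasurableSpace E] [MeasurableSpace Ξ] {h : E → Ξ → ENNReal}
    (hh : Measurable (Function.uncurry h)) {X : Ω → E} (hX : Measurable[m] X) {ξ : Ω → Ξ}
    (hξ : Measurable[m0] ξ) (hind : Indep (MeasurableSpace.comap ξ inferInstance) m P)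
    {c : ENNReal} (hc : ∀ u, ∫⁻ ω, h u (ξ ω) ∂P ≤ c) : ∫⁻ ω, h (X ω) (ξ ω) ∂P ≤ c := by
  have hX0 : Measurable[m0] X := hX.mono hm le_rfl
  have hindep : IndepFun X ξ P := by
    rw [IndepFun_iff_Indep]
    exact (indep_of_indep_of_le_right hind hX.comap_le).symm
  have hmap := (indepFun_iff_map_prod_eq_prod_map_map hX0.aemeasurable hξ.aemeasurable).1 hindep
  have : IsProbabilityMeasure (P.map X) := Measure.isProbabilityMeasure_map hX0.aemeasurable
  have : IsProbabilityMeasure (P.map ξ) := Measure.isProbabilityMeasure_map hξ.aemeasurable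
  calc ∫⁻ ω, h (X ω) (ξ ω) ∂P = ∫⁻ q, Function.uncurry h q ∂(P.map fun ω => (X ω, ξ ω)) := by
        rw [lintegral_map hh (hX0.prodMk hξ)]; rfl
    _ = ∫⁻ u, ∫⁻ s, h u s ∂(P.map ξ) ∂(P.map X) := by
        rw [hmap, lintegral_prod _ hh.aemeasurable]; rfl
    _ ≤ ∫⁻ _u, c ∂(P.map X) := by
        refine lintegral_mono fun u => ?_
        have hu : Measurable (h u) := hh.comp measurable_prodMk_left
        rw [lintegral_map hu hξ]
        exact hc u
    _ = c := by simp

/-- Jensen's inequality for the square. -/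
lemma lintegral_ofReal_le_sqrt [IsProbabilityMeasure P] {F : Ω → ℝ} {b : ℝ} (hb : 0 ≤ b)
    (hF : ∫⁻ ω, ENNReal.ofReal (F ω ^ 2) ∂P ≤ ENNReal.ofReal b) :
    ∫⁻ ω, ENNReal.ofReal (F ω) ∂P ≤ ENNReal.ofReal √b := by
  refine ENNReal.le_of_forall_pos_le_add fun ε hε _ => ?_
  set s : ℝ := √b + ε with hs
  have hsb : 0 ≤ √b := Real.sqrt_nonneg b
  have hε' : (0 : ℝ) < ε := by exact_mod_cast hε
  have hspos : 0 < s := by positivity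
  have hbs : b ≤ s ^ 2 := by
    calc b = √b ^ 2 := (Real.sq_sqrt hb).symm
      _ ≤ s ^ 2 := by gcongr; linarith
  calc ∫⁻ ω, ENNReal.ofReal (F ω) ∂P
      ≤ ∫⁻ ω, (ENNReal.ofReal (1 / (2 * s)) * ENNReal.ofReal (F ω ^ 2) +
          ENNReal.ofReal (s / 2)) ∂P := by
        refine lintegral_mono fun ω => ?_
        rw [← ENNReal.ofReal_mul (by positivity), ← ENNReal.ofReal_add (by positivity)
          (by positivity)]
        apply ENNReal.ofReal_le_ofReal
        have : 1 / (2 * s) * F ω ^ 2 + s / 2 - F ω = (F ω - s) ^ 2 / (2 * s) := by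
          field_simp; ring
        have h2 : 0 ≤ (F ω - s) ^ 2 / (2 * s) := by positivity
        linarith
    _ ≤ ENNReal.ofReal (1 / (2 * s)) * ENNReal.ofReal b + ENNReal.ofReal (s / 2) := by
        rw [lintegral_add_right _ measurable_const, lintegral_const_mul' _ _ ENNReal.ofReal_ne_top]
        simp only [lintegral_const, measure_univ, mul_one]
        gcongr
    _ ≤ ENNReal.ofReal s := by
        rw [← ENNReal.ofReal_mul (by positivity), ← ENNReal.ofReal_add (by positivity)
          (by positivity)]
        apply ENNReal.ofReal_le_ofReal
        have : 1 / (2 * s) * b ≤ 1 / (2 * s) * s ^ 2 := by gcongr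
        have e : 1 / (2 * s) * s ^ 2 = s / 2 := by field_simp
        linarith
    _ = ENNReal.ofReal √b + ε := by
        rw [hs, ENNReal.ofReal_add hsb hε'.le, ENNReal.ofReal_coe_nnreal]

end Expectation

section Rates

/-- A convex combination of `1` and `ζ` is dominated by the rate of the squared norms. -/
lemma one_sub_add_mul_le_sqrt {p q ζ : ℝ} (hq0 : 0 ≤ q) (hqp : q ≤ p) (hp1 : p ≤ 1) (hζ0 : 0 ≤ ζ)
    (hζ1 : ζ ≤ 1) : 1 - p + p * ζ ≤ √(1 - (1 - ζ ^ 2) * q) := by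
  apply Real.le_sqrt_of_sq_le
  have h1 : 1 - p + p * ζ ≤ 1 - q + q * ζ := by nlinarith
  have h2 : 0 ≤ 1 - p + p * ζ := by nlinarith [mul_nonneg (hq0.trans hqp) hζ0]
  calc (1 - p + p * ζ) ^ 2 ≤ (1 - q + q * ζ) ^ 2 := by gcongr
    _ ≤ 1 - (1 - ζ ^ 2) * q := by nlinarith [mul_nonneg (mul_nonneg hq0
          (sub_nonneg.2 (hqp.trans hp1))) (sq_nonneg (1 - ζ))]

end Rates

/-! ### Averages and stacked norms -/

section Mean

variable {V : Type*} [Fintype V] {E : Type*} [NormedAddCommGroup E] [NormedSpace ℝ E]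

/-- The average of the vectors of all agents, the value on which exact coordination agrees. -/
noncomputable def mean (y : V → E) : E := (Fintype.card V : ℝ)⁻¹ • ∑ j, y j

lemma norm_mean_sub_mean_le (a b : V → E) :
    ‖mean a - mean b‖ ≤ (Fintype.card V : ℝ)⁻¹ * ∑ j, ‖a j - b j‖ := by
  rw [mean, mean, ← smul_sub, ← Finset.sum_sub_distrib, norm_smul, Real.norm_eq_abs,
    abs_of_nonneg (by positivity)]
  gcongr
  exact norm_sum_le _ _

lemma norm_mean_sub_mean_sq_le (a b : V → E) :
    ‖mean a - mean b‖ ^ 2 ≤ (Fintype.card V : ℝ)⁻¹ * ∑ j, ‖a j - b j‖ ^ 2 := by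
  have h1 : ‖mean a - mean b‖ ^ 2 ≤ ((Fintype.card V : ℝ)⁻¹ * ∑ j, ‖a j - b j‖) ^ 2 := by
    gcongr
    exact norm_mean_sub_mean_le a b
  refine h1.trans ?_
  have h2 : (∑ j, ‖a j - b j‖) ^ 2 ≤ (Fintype.card V : ℝ) * ∑ j, ‖a j - b j‖ ^ 2 :=
    sq_sum_le_card_mul_sum_sq
  rw [mul_pow]
  calc _ ≤ (Fintype.card V : ℝ)⁻¹ ^ 2 * ((Fintype.card V : ℝ) * ∑ j, ‖a j - b j‖ ^ 2) := by gcongr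
    _ = _ := by
      rcases eq_or_ne (Fintype.card V : ℝ) 0 with h | h
      · simp [h]
      · field_simp

lemma mean_const_sub [Nonempty V] (u : E) (g : V → E) (α : ℝ) (hg : ∑ j, g j = 0) :
    mean (fun j => u - α • g j) = u := by
  have hN : (Fintype.card V : ℝ) ≠ 0 := by exact_mod_cast Fintype.card_ne_zero
  rw [mean, Finset.sum_sub_distrib, ← Finset.smul_sum, hg, smul_zero, sub_zero, Finset.sum_const,
    Finset.card_univ, ← Nat.cast_smul_eq_nsmul ℝ, smul_smul, inv_mul_cancel₀ hN, one_smul]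

end Mean

section StackNorm

variable {V : Type*} [Fintype V] {n : ℕ}

lemma sq_stackNorm (v : V → Vec n) : stackNorm v ^ 2 = ∑ i, ‖v i‖ ^ 2 := by
  rw [stackNorm, PiLp.norm_sq_eq_of_L2]

lemma stackNorm_nonneg (v : V → Vec n) : 0 ≤ stackNorm v := norm_nonneg _

lemma stackNorm_le {v : V → Vec n} {r : ℝ} (hr : 0 ≤ r) (h : ∀ i, ‖v i‖ ≤ r) :
    stackNorm v ≤ √(Fintype.card V) * r := by
  apply abs_le_of_sq_le_sq' _ (by positivity) |>.2
  rw [sq_stackNorm, mul_pow, Real.sq_sqrt (by positivity)]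
  calc _ ≤ ∑ _i : V, r ^ 2 := Finset.sum_le_sum fun i _ => by
        gcongr; exact h i
    _ = _ := by simp

end StackNorm

lemma measurable_of_coord {V Ω E : Type*} [MeasurableSpace E] {m : MeasurableSpace Ω}
    {F : Ω → V → E} (h : ∀ i, Measurable fun ω => F ω i) : Measurable F :=
  measurable_pi_iff.2 h

lemma measurable_norm_sub_coord {V Ω : Type*} {n : ℕ} {m : MeasurableSpace Ω}
    {a b : Ω → V → Vec n} (ha : Measurable a) (hb : Measurable b) (j : V) :
    Measurable fun ω => ‖a ω j - b ω j‖ := by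
  fun_prop

lemma lintegral_ofReal_mul_sum_le {V Ω : Type*} [Fintype V] [MeasurableSpace Ω] {P : Measure Ω}
    {F : V → Ω → ℝ} (hF0 : ∀ j ω, 0 ≤ F j ω) (hF : ∀ j, Measurable (F j)) {c : ℝ} (hc : 0 ≤ c)
    {g : V → ℝ} (hg : ∀ j, 0 ≤ g j)
    (h : ∀ j, ∫⁻ ω, ENNReal.ofReal (F j ω) ∂P ≤ ENNReal.ofReal (g j)) :
    ∫⁻ ω, ENNReal.ofReal (c * ∑ j, F j ω) ∂P ≤ ENNReal.ofReal (c * ∑ j, g j) := by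
  have e : ∀ ω, ENNReal.ofReal (c * ∑ j, F j ω) =
      ENNReal.ofReal c * ∑ j, ENNReal.ofReal (F j ω) := by
    intro ω
    rw [ENNReal.ofReal_mul hc, ENNReal.ofReal_sum_of_nonneg fun j _ => hF0 j ω]
  simp only [e]
  rw [lintegral_const_mul' _ _ ENNReal.ofReal_ne_top,
    lintegral_finsetSum _ fun j _ => (hF j).ennreal_ofReal, ENNReal.ofReal_mul hc,
    ENNReal.ofReal_sum_of_nonneg fun j _ => hg j]
  gcongr with j
  exact h j

/-! ### The noise-free reference trajectory -/

section ReferenceTrajectory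

variable {V Ω : Type*} [Fintype V] {n : ℕ}

open Classical in
/-- The trajectory of the local variables `y` with the same activations, but with exact steps `T`
and exact averaging: an active agent applies its step to the average, an idle one keeps its
value. -/
noncomputable def exactTraj (T : V → Vec n → Vec n) (active : ℕ → V → Set Ω) (y₀ : V → Vec n) :
    ℕ → Ω → V → Vec n
  | 0 => fun _ => y₀
  | k + 1 => fun ω i => if ω ∈ active (k + 1) i then T i (mean (exactTraj T active y₀ k ω))
      else exactTraj T active y₀ k ω i

lemma exactTraj_active {T : V → Vec n → Vec n} {active : ℕ → V → Set Ω} {y₀ : V → Vec n} {k : ℕ}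
    {ω : Ω} {i : V} (h : ω ∈ active (k + 1) i) :
    exactTraj T active y₀ (k + 1) ω i = T i (mean (exactTraj T active y₀ k ω)) := if_pos h

lemma exactTraj_idle {T : V → Vec n → Vec n} {active : ℕ → V → Set Ω} {y₀ : V → Vec n} {k : ℕ}
    {ω : Ω} {i : V} (h : ω ∉ active (k + 1) i) :
    exactTraj T active y₀ (k + 1) ω i = exactTraj T active y₀ k ω i := if_neg h

variable {m0 : MeasurableSpace Ω}

lemma measurable_exactTraj {ℱ : Filtration ℕ m0} {T : V → Vec n → Vec n}
    (hT : ∀ i, Measurable (T i)) {active : ℕ → V → Set Ω}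
    (hA : ∀ k i, MeasurableSet[ℱ (k + 1)] (active k i)) (y₀ : V → Vec n) (k : ℕ) :
    Measurable[ℱ (k + 1)] (exactTraj T active y₀ k) := by
  induction k with
  | zero => exact measurable_const
  | succ k ih =>
    have hle : ℱ (k + 1) ≤ ℱ (k + 1 + 1) := ℱ.mono (Nat.le_succ _)
    have ih' : Measurable[ℱ (k + 1 + 1)] (exactTraj T active y₀ k) := ih.mono hle le_rfl
    refine measurable_of_coord fun i => ?_
    refine Measurable.ite (hA (k + 1) i) ((hT i).comp ?_) ((measurable_pi_apply i).comp ih')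
    have hmean : Measurable (mean : (V → Vec n) → Vec n) := by unfold mean; fun_prop
    exact hmean.comp ih'

/-- Second moments of the reference trajectory. Weighting agent `i` by `1 / p i` compensates the
rarity of its steps, and the weighted sum contracts by `1 - (1 - ζ²) q` per iteration. -/
lemma exists_secondMoment_bound {P : Measure Ω} [IsProbabilityMeasure P] {ℱ : Filtration ℕ m0}
    {T : V → Vec n → Vec n} (hTm : ∀ i, Measurable (T i)) {ζ : ℝ}
    (hT : ∀ i u v, ‖T i u - T i v‖ ≤ ζ * ‖u - v‖) {xs : Vec n}
    (hxs : mean (fun i => T i xs) = xs) {active : ℕ → V → Set Ω}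
    (hA : ∀ k i, MeasurableSet[ℱ (k + 1)] (active k i)) {p : V → ℝ} {q : ℝ}
    (hp : ∀ i, 0 < p i ∧ p i ≤ 1) (hq : ∀ i, q ≤ p i) (hζ1 : ζ ^ 2 ≤ 1) (hq1 : q ≤ 1)
    (hP : ∀ k i s, MeasurableSet[ℱ k] s → P (active k i ∩ s) = ENNReal.ofReal (p i) * P s)
    (y₀ : V → Vec n) (k : ℕ) :
    ∃ g : V → ℝ, (∀ i, 0 ≤ g i) ∧
      (∀ i, ∫⁻ ω, ENNReal.ofReal (‖exactTraj T active y₀ k ω i - T i xs‖ ^ 2) ∂P ≤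
        ENNReal.ofReal (g i)) ∧
      ∑ i, g i / p i ≤ (1 - (1 - ζ ^ 2) * q) ^ k * ∑ i, ‖y₀ i - T i xs‖ ^ 2 / p i := by
  induction k with
  | zero => exact ⟨fun i => ‖y₀ i - T i xs‖ ^ 2, fun i => by positivity, fun i => by
      simp [exactTraj], by simp⟩
  | succ k ih =>
    obtain ⟨g, hg0, hg, hgsum⟩ := ih
    set Y := exactTraj T active y₀ k with hY
    have hYm : Measurable[ℱ (k + 1)] Y := measurable_exactTraj hTm hA y₀ k
    have hYi : ∀ i, Measurable[ℱ (k + 1)] fun ω => ‖Y ω i - T i xs‖ ^ 2 := fun i =>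
      (by fun_prop : Measurable fun v : V → Vec n => ‖v i - T i xs‖ ^ 2).comp hYm
    have hc : 0 ≤ ζ ^ 2 * (Fintype.card V : ℝ)⁻¹ := by positivity
    refine ⟨fun i => p i * (ζ ^ 2 * (Fintype.card V : ℝ)⁻¹ * ∑ j, g j) + (1 - p i) * g i,
      fun i => ?_, fun i => ?_, ?_⟩
    · have h1 := (hp i).1
      have h2 := (hp i).2
      have h3 := hg0 i
      have h4 : 0 ≤ ∑ j, g j := Finset.sum_nonneg fun j _ => hg0 j
      have h5 : 0 ≤ 1 - p i := by linarith
      positivity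
    · refine le_trans (lintegral_mono fun ω => ?_) (lintegral_indicator_add_le (ℱ.le (k + 1))
        (ℱ.le _ _ (hA (k + 1) i)) (hp i).1.le (hp i).2 (hP (k + 1) i)
        (f := fun ω => ENNReal.ofReal
          (ζ ^ 2 * (Fintype.card V : ℝ)⁻¹ * ∑ j, ‖Y ω j - T j xs‖ ^ 2))
        (g := fun ω => ENNReal.ofReal (‖Y ω i - T i xs‖ ^ 2))
        ((Finset.measurable_fun_sum _ fun j _ => hYi j).const_mul _).ennreal_ofReal
        (hYi i).ennreal_ofReal
        (mul_nonneg hc (Finset.sum_nonneg fun j _ => hg0 j)) (hg0 i)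
        (lintegral_ofReal_mul_sum_le (fun _ _ => by positivity)
          (fun j => (hYi j).mono (ℱ.le _) le_rfl) hc hg0 hg) (hg i))
      by_cases hω : ω ∈ active (k + 1) i
      · have hωc : ω ∉ (active (k + 1) i)ᶜ := fun h => h hω
        rw [exactTraj_active hω, Set.indicator_of_mem hω, Set.indicator_of_notMem hωc, add_zero]
        apply ENNReal.ofReal_le_ofReal
        rw [← hY]
        have h1 : ‖T i (mean (Y ω)) - T i xs‖ ^ 2 ≤ (ζ * ‖mean (Y ω) - xs‖) ^ 2 := by
          gcongr; exact hT i _ _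
        have h2 := norm_mean_sub_mean_sq_le (Y ω) fun j => T j xs
        rw [hxs] at h2
        calc _ ≤ ζ ^ 2 * ‖mean (Y ω) - xs‖ ^ 2 := by rw [← mul_pow]; exact h1
          _ ≤ _ := by rw [mul_assoc]; gcongr
      · rw [exactTraj_idle hω, Set.indicator_of_notMem hω,
          Set.indicator_of_mem (Set.mem_compl hω), zero_add]
    · have hχ : 0 ≤ 1 - (1 - ζ ^ 2) * q := by
        nlinarith [sq_nonneg ζ, mul_nonneg (sub_nonneg.2 hζ1) (sub_nonneg.2 hq1)]
      rw [pow_succ' (1 - (1 - ζ ^ 2) * q) k, mul_assoc (1 - (1 - ζ ^ 2) * q)]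
      refine le_trans ?_ (mul_le_mul_of_nonneg_left hgsum hχ)
      rcases isEmpty_or_nonempty V with hV | hV
      · simp
      have hN : (Fintype.card V : ℝ) ≠ 0 := by exact_mod_cast Fintype.card_ne_zero
      have e : ∀ i, (p i * (ζ ^ 2 * (Fintype.card V : ℝ)⁻¹ * ∑ j, g j) + (1 - p i) * g i) / p i =
          (Fintype.card V : ℝ)⁻¹ * (ζ ^ 2 * ∑ j, g j) + (1 - p i) * (g i / p i) := by
        intro i
        have := (hp i).1
        field_simp
      simp only [e]
      rw [Finset.sum_add_distrib, Finset.sum_const, Finset.card_univ, nsmul_eq_mul,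
        mul_inv_cancel_left₀ hN, Finset.mul_sum, Finset.mul_sum, ← Finset.sum_add_distrib]
      refine Finset.sum_le_sum fun i _ => ?_
      have h1 := (hp i).1
      have h2 : g i = p i * (g i / p i) := by field_simp
      have h3 : 0 ≤ g i / p i := div_nonneg (hg0 i) h1.le
      have h4 := hq i
      calc ζ ^ 2 * g i + (1 - p i) * (g i / p i) = (1 - (1 - ζ ^ 2) * p i) * (g i / p i) := by
            nth_rewrite 1 [h2]; ring
        _ ≤ _ := by
            apply mul_le_mul_of_nonneg_right _ h3
            nlinarith

/-- The distance of the averaged reference trajectory to its limit, in expectation. -/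
lemma lintegral_mean_exactTraj_le [Nonempty V] {P : Measure Ω} [IsProbabilityMeasure P]
    {ℱ : Filtration ℕ m0} {T : V → Vec n → Vec n} (hTm : ∀ i, Measurable (T i)) {ζ : ℝ}
    (hζ0 : 0 ≤ ζ) (hζ1 : ζ ≤ 1) (hT : ∀ i u v, ‖T i u - T i v‖ ≤ ζ * ‖u - v‖) {xs : Vec n}
    (hxs : mean (fun i => T i xs) = xs) {active : ℕ → V → Set Ω}
    (hA : ∀ k i, MeasurableSet[ℱ (k + 1)] (active k i)) {p : V → ℝ} {q r : ℝ}
    (hp : ∀ i, 0 < p i ∧ p i ≤ 1) (hq0 : 0 < q) (hq : ∀ i, q ≤ p i) (hr : ∀ i, p i ≤ r)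
    (hP : ∀ k i s, MeasurableSet[ℱ k] s → P (active k i ∩ s) = ENNReal.ofReal (p i) * P s)
    (x₀ : V → Vec n) (k : ℕ) :
    ∫⁻ ω, ENNReal.ofReal ‖mean (exactTraj T active (fun i => T i (x₀ i)) k ω) - xs‖ ∂P ≤
      ENNReal.ofReal √((Fintype.card V : ℝ)⁻¹ *
        (r / q * (√(1 - (1 - ζ ^ 2) * q) ^ (k + 1) * stackNorm fun i => x₀ i - xs) ^ 2)) := by
  obtain ⟨i₀⟩ := ‹Nonempty V›
  have hq1 : q ≤ 1 := (hq i₀).trans (hp i₀).2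
  have hr0 : 0 < r := (hp i₀).1.trans_le (hr i₀)
  have hζ2 : ζ ^ 2 ≤ 1 := pow_le_one₀ hζ0 hζ1
  obtain ⟨g, hg0, hg, hgsum⟩ := exists_secondMoment_bound hTm hT hxs hA hp hq hζ2 hq1 hP
    (fun i => T i (x₀ i)) k
  set Y := exactTraj T active (fun i => T i (x₀ i)) k with hY
  set D := stackNorm fun i => x₀ i - xs with hD
  have hYm : Measurable Y := (measurable_exactTraj hTm hA _ k).mono (ℱ.le _) le_rfl
  set χ2 : ℝ := 1 - (1 - ζ ^ 2) * q with hχ2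
  have hζχ : ζ ^ 2 ≤ χ2 := by nlinarith
  have hχ0 : 0 ≤ χ2 := (sq_nonneg ζ).trans hζχ
  have hinit : ∑ i, ‖T i (x₀ i) - T i xs‖ ^ 2 / p i ≤ ζ ^ 2 * D ^ 2 / q := by
    rw [hD, sq_stackNorm, Finset.mul_sum, Finset.sum_div]
    refine Finset.sum_le_sum fun i _ => ?_
    have h1 : ‖T i (x₀ i) - T i xs‖ ^ 2 ≤ (ζ * ‖x₀ i - xs‖) ^ 2 := by
      gcongr; exact hT i _ _
    rw [mul_pow] at h1
    have h2 := hq i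
    gcongr
  have hsum : ∑ i, g i ≤ r / q * (√χ2 ^ (k + 1) * D) ^ 2 := by
    calc ∑ i, g i ≤ ∑ i, r * (g i / p i) := by
          refine Finset.sum_le_sum fun i _ => ?_
          have h1 := (hp i).1
          calc g i = p i * (g i / p i) := by field_simp
            _ ≤ r * (g i / p i) :=
              mul_le_mul_of_nonneg_right (hr i) (div_nonneg (hg0 i) h1.le)
      _ = r * ∑ i, g i / p i := by rw [Finset.mul_sum]
      _ ≤ r * (χ2 ^ k * (ζ ^ 2 * D ^ 2 / q)) := by
          gcongr
          exact hgsum.trans (by gcongr)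
      _ ≤ r * (χ2 ^ k * (χ2 * D ^ 2 / q)) := by gcongr
      _ = r / q * (√χ2 ^ (k + 1) * D) ^ 2 := by
          rw [mul_pow, ← pow_mul, mul_comm (k + 1) 2, pow_mul, Real.sq_sqrt hχ0]
          ring
  refine lintegral_ofReal_le_sqrt (by positivity) ?_
  have hN : 0 ≤ (Fintype.card V : ℝ)⁻¹ := by positivity
  calc _ ≤ ∫⁻ ω, ENNReal.ofReal ((Fintype.card V : ℝ)⁻¹ * ∑ j, ‖Y ω j - T j xs‖ ^ 2) ∂P := by
        refine lintegral_mono fun ω => ENNReal.ofReal_le_ofReal ?_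
        have h2 := norm_mean_sub_mean_sq_le (Y ω) fun j => T j xs
        rwa [hxs] at h2
    _ ≤ ENNReal.ofReal ((Fintype.card V : ℝ)⁻¹ * ∑ j, g j) :=
        lintegral_ofReal_mul_sum_le (fun _ _ => by positivity) (fun j =>
          (by fun_prop : Measurable fun ω => ‖Y ω j - T j xs‖ ^ 2)) hN hg0 hg
    _ ≤ _ := by
        apply ENNReal.ofReal_le_ofReal
        gcongr

end ReferenceTrajectory

/-! ### Deviation from the reference trajectory -/

section Adapted

variable {V Ω Ξ : Type*} [MeasurableSpace Ω] [MeasurableSpace Ξ] [Fintype V] [DecidableEq V]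
  {G : SimpleGraph V} [DecidableRel G.Adj] {n : ℕ} {P : Measure Ω}
  {ℱ : Filtration ℕ (inferInstance : MeasurableSpace Ω)} {f : V → Vec n → ℝ} {p : V → ℝ} {τ : ℝ}
  {grad : V → Vec n → Ξ → Vec n} {ξ : ℕ → V → Ω → Ξ} {active : ℕ → V → Set Ω}
  {z₀ : ℕ → Ω → EdgeVec G n} {L : ℕ → V → Ω → ℕ} {ρ Δ θ μ α : ℝ} {x₀ : V → Vec n}
  {x y : ℕ → Ω → V → Vec n}

/-- The states `x k` are known before iteration `k`, the local variables `y k` after it. -/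
lemma IsTrajectory.adapted (hR : RandomSetup P ℱ f p τ grad ξ active z₀ L)
    (hT : IsTrajectory G ρ Δ θ μ α grad ξ active z₀ L x₀ x y) (k : ℕ) :
    Measurable[ℱ k] (x k) ∧ Measurable[ℱ (k + 1)] (y k) := by
  have hstep : ∀ k i, Measurable[ℱ k] (x k) →
      Measurable[ℱ (k + 1)] fun ω => x k ω i - α • grad i (x k ω i) (ξ k i ω) := by
    intro k i hx
    have hxi : Measurable[ℱ (k + 1)] fun ω => x k ω i :=
      (measurable_pi_apply i).comp (hx.mono (ℱ.mono (Nat.le_succ k)) le_rfl)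
    have hg : Measurable[ℱ (k + 1)] fun ω => grad i (x k ω i) (ξ k i ω) :=
      (hR.measurable_grad i).comp (hxi.prodMk (hR.measurable_sample k i))
    exact hxi.sub (hg.const_smul α)
  induction k with
  | zero =>
    have hx : Measurable[ℱ 0] (x 0) := by
      rw [show x 0 = fun _ => x₀ from funext hT.init]
      exact measurable_const
    refine ⟨hx, measurable_of_coord fun i => ?_⟩
    rw [show (fun ω => y 0 ω i) = _ from funext fun ω => hT.first_step ω i]
    exact hstep 0 i hx
  | succ k ih =>
    have hx : Measurable[ℱ (k + 1)] (x (k + 1)) := by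
      refine measurable_of_coord fun i => ?_
      rw [show (fun ω => x (k + 1) ω i) = _ from funext fun ω => hT.coordination k ω i]
      exact measurable_wIter ρ Δ ih.2 (hR.measurable_aux k) (hR.measurable_rounds k i) i
    refine ⟨hx, measurable_of_coord fun i => ?_⟩
    classical
    have e : (fun ω => y (k + 1) ω i) = fun ω => if ω ∈ active (k + 1) i then
        x (k + 1) ω i - α • grad i (x (k + 1) ω i) (ξ (k + 1) i ω) else y k ω i := by
      funext ω
      split_ifs with h
      · exact hT.active_step k ω i h
      · exact hT.idle_step k ω i h
    rw [e]
    exact Measurable.ite (hR.measurable_active (k + 1) i) (hstep (k + 1) i hx)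
      ((measurable_pi_apply i).comp (ih.2.mono (ℱ.mono (Nat.le_succ _)) le_rfl))

/-- The expected gradient error along the trajectory. -/
lemma IsTrajectory.lintegral_gradient_error_le [IsProbabilityMeasure P]
    (hR : RandomSetup P ℱ f p τ grad ξ active z₀ L)
    (hT : IsTrajectory G ρ Δ θ μ α grad ξ active z₀ L x₀ x y)
    (hf : ∀ i, Measurable (gradient (f i))) (k : ℕ) (i : V) :
    ∫⁻ ω, ENNReal.ofReal ‖grad i (x k ω i) (ξ k i ω) - gradient (f i) (x k ω i)‖ ∂P ≤
      ENNReal.ofReal τ := by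
  refine lintegral_comp_le_of_indep (ℱ.le k)
    (h := fun u s => ENNReal.ofReal ‖grad i u s - gradient (f i) u‖) ?_
    ((measurable_pi_apply i).comp (hT.adapted hR k).1)
    ((hR.measurable_sample k i).mono (ℱ.le _) le_rfl) (hR.indep_sample k i) (fun u => ?_)
  · exact (((hR.measurable_grad i).sub ((hf i).comp measurable_fst)).norm).ennreal_ofReal
  · simp only [ofReal_norm]
    exact hR.grad_error k i u

/-- Expected deviation of each agent from the reference trajectory. In the maximum over the agents
of these first moments, an iteration contracts by `χ ≥ 1 - p i + p i ζ` and adds a coordination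
error and a gradient error; gradient errors of different agents may depend on each other. -/
lemma IsTrajectory.lintegral_deviation_le [IsProbabilityMeasure P]
    (hR : RandomSetup P ℱ f p τ grad ξ active z₀ L)
    (hT : IsTrajectory G ρ Δ θ μ α grad ξ active z₀ L x₀ x y)
    (hf : ∀ i, Measurable (gradient (f i))) {ζ χ e : ℝ} (hζ0 : 0 ≤ ζ) (hα : 0 ≤ α) (hτ : 0 ≤ τ)
    (hlip : ∀ i u v, ‖(u - α • gradient (f i) u) - (v - α • gradient (f i) v)‖ ≤ ζ * ‖u - v‖)
    (hp : ∀ i, 0 < p i ∧ p i ≤ 1) (hχ0 : 0 ≤ χ) (hχ : ∀ i, 1 - p i + p i * ζ ≤ χ) (he0 : 0 ≤ e)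
    (he : ∀ k ω i, ‖x (k + 1) ω i - mean (y k ω)‖ ≤ e) (k : ℕ) (i : V) :
    ∫⁻ ω, ENNReal.ofReal ‖y k ω i - exactTraj (fun i u => u - α • gradient (f i) u) active
        (fun i => x₀ i - α • gradient (f i) (x₀ i)) k ω i‖ ∂P ≤
      ENNReal.ofReal ((α * τ + e) * ∑ j ∈ Finset.range (k + 1), χ ^ j - e) := by
  set T : V → Vec n → Vec n := fun i u => u - α • gradient (f i) u with hTdef
  set y₀ : V → Vec n := fun i => x₀ i - α • gradient (f i) (x₀ i) with hy₀
  have hTm : ∀ i, Measurable (T i) := fun i => measurable_id.sub ((hf i).const_smul α)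
  have hnoise : ∀ k i, Measurable fun ω =>
      ENNReal.ofReal ‖grad i (x k ω i) (ξ k i ω) - gradient (f i) (x k ω i)‖ := by
    intro k i
    have hx : Measurable fun ω => x k ω i :=
      (measurable_pi_apply i).comp ((hT.adapted hR k).1.mono (ℱ.le k) le_rfl)
    have hξ : Measurable (ξ k i) := (hR.measurable_sample k i).mono (ℱ.le _) le_rfl
    exact (((hR.measurable_grad i).comp (hx.prodMk hξ)).sub ((hf i).comp hx)).norm.ennreal_ofReal
  have hnoise_le : ∀ k i, ∫⁻ ω, ENNReal.ofReal α *
      ENNReal.ofReal ‖grad i (x k ω i) (ξ k i ω) - gradient (f i) (x k ω i)‖ ∂P ≤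
      ENNReal.ofReal (α * τ) := by
    intro k i
    rw [lintegral_const_mul' _ _ ENNReal.ofReal_ne_top, ENNReal.ofReal_mul hα]
    gcongr
    exact hT.lintegral_gradient_error_le hR hf k i
  induction k generalizing i with
  | zero =>
    refine le_trans (lintegral_mono fun ω => ?_) ((hnoise_le 0 i).trans ?_)
    · rw [← ENNReal.ofReal_mul hα]
      apply ENNReal.ofReal_le_ofReal
      have h1 : y 0 ω i - exactTraj T active y₀ 0 ω i =
          -(α • (grad i (x 0 ω i) (ξ 0 i ω) - gradient (f i) (x 0 ω i))) := by
        rw [hT.first_step, hT.init]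
        simp only [exactTraj, hy₀]
        module
      rw [h1, norm_neg, norm_smul, Real.norm_eq_abs, abs_of_nonneg hα]
    · simp
  | succ k ih =>
    set Y := exactTraj T active y₀ k with hY
    set B : ℝ := (α * τ + e) * ∑ j ∈ Finset.range (k + 1), χ ^ j - e with hB
    have hατ : 0 ≤ α * τ := mul_nonneg hα hτ
    have hB0 : 0 ≤ B := by
      have h1 : 1 ≤ ∑ j ∈ Finset.range (k + 1), χ ^ j := by
        rw [Finset.sum_range_succ', pow_zero]
        exact le_add_of_nonneg_left (Finset.sum_nonneg fun j _ => by positivity)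
      nlinarith
    have hYm : Measurable[ℱ (k + 1)] Y := measurable_exactTraj hTm hR.measurable_active y₀ k
    have hδ : ∀ j, Measurable[ℱ (k + 1)] fun ω => ‖y k ω j - Y ω j‖ :=
      measurable_norm_sub_coord (hT.adapted hR k).2 hYm
    have hc : 0 ≤ ζ * (Fintype.card V : ℝ)⁻¹ := by positivity
    have hN : (Fintype.card V : ℝ) ≠ 0 := by
      have : Nonempty V := ⟨i⟩
      exact_mod_cast Fintype.card_ne_zero
    set F : Ω → ENNReal := fun ω => ENNReal.ofReal
      (ζ * (Fintype.card V : ℝ)⁻¹ * ∑ j, ‖y k ω j - Y ω j‖) + ENNReal.ofReal (ζ * e) with hF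
    have hFm : Measurable[ℱ (k + 1)] F := (((Finset.measurable_fun_sum _ fun j _ =>
      hδ j).const_mul _).ennreal_ofReal).add_const _
    have hFint : ∫⁻ ω, F ω ∂P ≤ ENNReal.ofReal (ζ * (B + e)) := by
      rw [hF, lintegral_add_right _ measurable_const, lintegral_const, measure_univ, mul_one]
      have h1 := lintegral_ofReal_mul_sum_le (P := P) (F := fun j ω => ‖y k ω j - Y ω j‖)
        (fun _ _ => norm_nonneg _) (fun j => (hδ j).mono (ℱ.le _) le_rfl) hc
        (g := fun _ => B) (fun _ => hB0) ih
      have h2 : ζ * (Fintype.card V : ℝ)⁻¹ * ∑ _j : V, B = ζ * B := by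
        rw [Finset.sum_const, Finset.card_univ, nsmul_eq_mul]
        field_simp
      rw [h2] at h1
      rw [mul_add, ENNReal.ofReal_add (by positivity) (by positivity)]
      gcongr
    have hchoice := lintegral_indicator_add_le (ℱ.le (k + 1))
      (ℱ.le _ _ (hR.measurable_active (k + 1) i)) (hp i).1.le (hp i).2
      (hR.prob_active (k + 1) i) hFm (hδ i).ennreal_ofReal (by positivity) hB0 hFint (ih i)
    calc _ ≤ ∫⁻ ω, (((active (k + 1) i).indicator F ω +
            (active (k + 1) i)ᶜ.indicator (fun ω => ENNReal.ofReal ‖y k ω i - Y ω i‖) ω) +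
            ENNReal.ofReal α * ENNReal.ofReal
              ‖grad i (x (k + 1) ω i) (ξ (k + 1) i ω) - gradient (f i) (x (k + 1) ω i)‖) ∂P := by
          refine lintegral_mono fun ω => ?_
          by_cases hω : ω ∈ active (k + 1) i
          · have hωc : ω ∉ (active (k + 1) i)ᶜ := fun h => h hω
            rw [exactTraj_active hω, Set.indicator_of_mem hω, Set.indicator_of_notMem hωc,
              add_zero, hT.active_step k ω i hω, congrFun hF ω, ← hY,
              ← ENNReal.ofReal_mul hα, ← ENNReal.ofReal_add (by positivity) (by positivity),
              ← ENNReal.ofReal_add (by positivity) (by positivity)]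
            apply ENNReal.ofReal_le_ofReal
            set X := x (k + 1) ω i with hX
            set g := grad i X (ξ (k + 1) i ω) with hg
            have e1 : X - α • g - T i (mean (Y ω)) =
                (T i X - T i (mean (Y ω))) - α • (g - gradient (f i) X) := by
              simp only [hTdef]; module
            have h1 : ‖T i X - T i (mean (Y ω))‖ ≤ ζ * ‖X - mean (Y ω)‖ := hlip i _ _
            have h2 : ‖X - mean (Y ω)‖ ≤
                e + (Fintype.card V : ℝ)⁻¹ * ∑ j, ‖y k ω j - Y ω j‖ := by
              rw [← sub_add_sub_cancel X (mean (y k ω)) (mean (Y ω))]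
              exact (norm_add_le _ _).trans
                (add_le_add (he k ω i) (norm_mean_sub_mean_le _ _))
            have h3 := mul_le_mul_of_nonneg_left h2 hζ0
            rw [e1]
            refine (norm_sub_le _ _).trans ?_
            rw [norm_smul, Real.norm_eq_abs, abs_of_nonneg hα]
            linarith
          · rw [exactTraj_idle hω, Set.indicator_of_notMem hω,
              Set.indicator_of_mem (Set.mem_compl hω), zero_add, hT.idle_step k ω i hω]
            exact le_self_add
      _ ≤ ENNReal.ofReal (p i * (ζ * (B + e)) + (1 - p i) * B) + ENNReal.ofReal (α * τ) := by
          rw [lintegral_add_right _ ((hnoise (k + 1) i).const_mul _)]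
          exact add_le_add hchoice (hnoise_le (k + 1) i)
      _ ≤ _ := by
          have hp0 := (hp i).1
          have hp1 : 0 ≤ 1 - p i := sub_nonneg.2 (hp i).2
          rw [← ENNReal.ofReal_add (by positivity) hατ]
          apply ENNReal.ofReal_le_ofReal
          rw [Finset.sum_range_succ', pow_zero]
          have e2 : ∑ j ∈ Finset.range (k + 1), χ ^ (j + 1) =
              χ * ∑ j ∈ Finset.range (k + 1), χ ^ j := by
            rw [Finset.mul_sum]
            exact Finset.sum_congr rfl fun j _ => pow_succ' χ j
          rw [e2]
          have h1 := mul_le_mul_of_nonneg_right (hχ i) (add_nonneg hB0 he0)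
          have h2 : 0 ≤ (1 - p i) * e := by positivity
          have h3 : (α * τ + e) * (χ * ∑ j ∈ Finset.range (k + 1), χ ^ j) = χ * (B + e) := by
            rw [hB]; ring
          rw [mul_add (α * τ + e), h3]
          linarith

end Adapted

/-! ### The rate of convergence -/

section Chi

variable {V : Type*} [Fintype V] [Nonempty V] {α lamL lamU : ℝ} {p : V → ℝ}

lemma iInf_pos_of_pos (hp : ∀ i, 0 < p i ∧ p i ≤ 1) : 0 < ⨅ i, p i := by
  obtain ⟨i, hi⟩ := exists_eq_ciInf_of_finite (f := p)
  exact hi ▸ (hp i).1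

lemma zeta_nonneg (α lamL lamU : ℝ) : 0 ≤ zeta α lamL lamU :=
  (abs_nonneg _).trans (le_max_left _ _)

lemma chi_lt_one (hζ : zeta α lamL lamU < 1) (hp : ∀ i, 0 < p i ∧ p i ≤ 1) :
    chi α lamL lamU p < 1 := by
  have h1 := iInf_pos_of_pos hp
  have h2 : 0 < 1 - zeta α lamL lamU ^ 2 :=
    sub_pos.2 (pow_lt_one₀ (zeta_nonneg _ _ _) hζ two_ne_zero)
  rw [chi, Real.sqrt_lt' one_pos]
  nlinarith [mul_pos h2 h1]

lemma chi_pos_or (hp : ∀ i, 0 < p i ∧ p i ≤ 1) :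
    0 < chi α lamL lamU p ∨ (zeta α lamL lamU = 0 ∧ ∀ i, p i = 1) := by
  have hq : ∀ i, ⨅ i, p i ≤ p i := ciInf_le (Set.finite_range p).bddBelow
  have hq0 := iInf_pos_of_pos hp
  have hq1 : ⨅ i, p i ≤ 1 := (hq (Classical.arbitrary V)).trans (hp _).2
  have hz := zeta_nonneg α lamL lamU
  rcases hz.eq_or_lt with h0 | h0
  · rcases hq1.eq_or_lt with h1 | h1
    · exact Or.inr ⟨h0.symm, fun i => le_antisymm (hp i).2 (h1 ▸ hq i)⟩
    · left
      rw [chi, ← h0]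
      apply Real.sqrt_pos.2
      linarith
  · left
    apply Real.sqrt_pos.2
    nlinarith [mul_pos (pow_pos h0 2) hq0]

end Chi

/-! ### The expected error -/

section MeanError

variable {V Ω : Type*} [Fintype V] {n : ℕ}

lemma measurable_stackNorm_sub {m : MeasurableSpace Ω} {a : Ω → V → Vec n} (ha : Measurable a)
    (u : Vec n) : Measurable fun ω => stackNorm fun i => a ω i - u := by
  unfold stackNorm
  fun_prop

/-- The error splits into that of the averaged reference trajectory, the average deviation from
the reference trajectory, and the error `e` of the last coordination. -/
lemma stackNorm_sub_le {e : ℝ} {a b Y : V → Vec n} {xs : Vec n} (he0 : 0 ≤ e)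
    (he : ∀ i, ‖a i - mean b‖ ≤ e) :
    stackNorm (fun i => a i - xs) ≤ √(Fintype.card V) *
      (‖mean Y - xs‖ + (Fintype.card V : ℝ)⁻¹ * ∑ j, ‖b j - Y j‖ + e) := by
  refine stackNorm_le (by positivity) fun i => ?_
  have h1 := norm_mean_sub_mean_le b Y
  have h2 : a i - xs = (mean Y - xs) + (mean b - mean Y) + (a i - mean b) := by abel
  rw [h2]
  exact norm_add₃_le.trans (add_le_add (add_le_add le_rfl h1) (he i))

/-- Expectation of the three contributions to the error. -/
lemma lintegral_three_errors_le [Nonempty V] {_ : MeasurableSpace Ω} {P : Measure Ω}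
    [IsProbabilityMeasure P] {a b Y : Ω → V → Vec n}
    {xs : Vec n} (hb : Measurable b) (hY : Measurable Y) {e A B : ℝ} (he0 : 0 ≤ e) (hA0 : 0 ≤ A)
    (hB0 : 0 ≤ B) (he : ∀ ω i, ‖a ω i - mean (b ω)‖ ≤ e)
    (hA : ∫⁻ ω, ENNReal.ofReal ‖mean (Y ω) - xs‖ ∂P ≤ ENNReal.ofReal A)
    (hB : ∀ i, ∫⁻ ω, ENNReal.ofReal ‖b ω i - Y ω i‖ ∂P ≤ ENNReal.ofReal B) :
    ∫⁻ ω, ENNReal.ofReal (stackNorm fun i => a ω i - xs) ∂P ≤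
      ENNReal.ofReal (√(Fintype.card V) * (A + B + e)) := by
  set N : ℝ := (Fintype.card V : ℝ) with hN
  have hNpos : 0 < N := by rw [hN]; exact_mod_cast Fintype.card_pos
  have h1 := lintegral_ofReal_mul_sum_le (P := P) (F := fun j ω => ‖b ω j - Y ω j‖)
    (fun _ _ => norm_nonneg _) (fun j => measurable_norm_sub_coord hb hY j)
    (inv_nonneg.2 hNpos.le) (g := fun _ => B) (fun _ => hB0) hB
  have h2 : N⁻¹ * ∑ _j : V, B = B := by
    rw [Finset.sum_const, Finset.card_univ, nsmul_eq_mul, inv_mul_cancel_left₀ hNpos.ne']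
  rw [h2] at h1
  have hm1 : Measurable fun ω => N⁻¹ * ∑ j, ‖b ω j - Y ω j‖ :=
    (Finset.measurable_fun_sum _ fun j _ => measurable_norm_sub_coord hb hY j).const_mul _
  calc _ ≤ ∫⁻ ω, ENNReal.ofReal √N * (ENNReal.ofReal ‖mean (Y ω) - xs‖ +
          ENNReal.ofReal (N⁻¹ * ∑ j, ‖b ω j - Y ω j‖) + ENNReal.ofReal e) ∂P := by
        refine lintegral_mono fun ω => ?_
        rw [← ENNReal.ofReal_add (by positivity) (by positivity),
          ← ENNReal.ofReal_add (by positivity) he0, ← ENNReal.ofReal_mul (by positivity)]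
        exact ENNReal.ofReal_le_ofReal (stackNorm_sub_le he0 (he ω))
    _ ≤ ENNReal.ofReal √N * (ENNReal.ofReal A + ENNReal.ofReal B + ENNReal.ofReal e) := by
        rw [lintegral_const_mul' _ _ ENNReal.ofReal_ne_top,
          lintegral_add_right _ measurable_const, lintegral_add_right _ hm1.ennreal_ofReal,
          lintegral_const, measure_univ, mul_one]
        gcongr
    _ = _ := by
        rw [ENNReal.ofReal_mul (by positivity), ENNReal.ofReal_add (by positivity) he0,
          ENNReal.ofReal_add hA0 hB0]

end MeanError

section Convergence

variable {V Ω Ξ : Type*} [MeasurableSpace Ω] [MeasurableSpace Ξ] [Fintype V] [DecidableEq V]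
  {G : SimpleGraph V} [DecidableRel G.Adj] {n : ℕ} {P : Measure Ω}
  {ℱ : Filtration ℕ (inferInstance : MeasurableSpace Ω)} {f : V → Vec n → ℝ} {p : V → ℝ} {τ : ℝ}
  {grad : V → Vec n → Ξ → Vec n} {ξ : ℕ → V → Ω → Ξ} {active : ℕ → V → Set Ω}
  {z₀ : ℕ → Ω → EdgeVec G n} {L : ℕ → V → Ω → ℕ} {ρ Δ θ μ α : ℝ} {x₀ : V → Vec n}
  {x y : ℕ → Ω → V → Vec n}

/-- The error bound in terms of a Lipschitz constant `ζ` of the gradient steps and a bound `e` on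
the error of coordination. -/
lemma IsTrajectory.lintegral_stackNorm_le [Nonempty V] [IsProbabilityMeasure P]
    (hR : RandomSetup P ℱ f p τ grad ξ active z₀ L)
    (hT : IsTrajectory G ρ Δ θ μ α grad ξ active z₀ L x₀ x y)
    (hf : ∀ i, Measurable (gradient (f i))) {ζ χ e : ℝ} (hζ0 : 0 ≤ ζ) (hζ1 : ζ ≤ 1) (hα : 0 ≤ α)
    (hτ : 0 ≤ τ)
    (hlip : ∀ i u v, ‖(u - α • gradient (f i) u) - (v - α • gradient (f i) v)‖ ≤ ζ * ‖u - v‖)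
    {xs : Vec n} (hxs : mean (fun i => xs - α • gradient (f i) xs) = xs)
    (hp : ∀ i, 0 < p i ∧ p i ≤ 1) (hχ : χ = √(1 - (1 - ζ ^ 2) * ⨅ i, p i)) (he0 : 0 ≤ e)
    (he : ∀ k ω i, ‖x (k + 1) ω i - mean (y k ω)‖ ≤ e) (k : ℕ) :
    ∫⁻ ω, ENNReal.ofReal (stackNorm fun i => x (k + 1) ω i - xs) ∂P ≤
      ENNReal.ofReal (√((⨆ i, p i) / (⨅ i, p i)) *
        (χ ^ (k + 1) * stackNorm (fun i => x₀ i - xs) +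
          (√(Fintype.card V) * e + α * τ * √(Fintype.card V)) *
            ∑ j ∈ Finset.range (k + 1), χ ^ j)) := by
  have hTm : ∀ i, Measurable fun u => u - α • gradient (f i) u := fun i =>
    measurable_id.sub ((hf i).const_smul α)
  have hq : ∀ i, ⨅ i, p i ≤ p i := ciInf_le (Set.finite_range p).bddBelow
  have hr : ∀ i, p i ≤ ⨆ i, p i := le_ciSup (Set.finite_range p).bddAbove
  have hq0 := iInf_pos_of_pos hp
  have hχ0 : 0 ≤ χ := hχ ▸ Real.sqrt_nonneg _
  have hχp : ∀ i, 1 - p i + p i * ζ ≤ χ := fun i =>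
    hχ ▸ one_sub_add_mul_le_sqrt hq0.le (hq i) (hp i).2 hζ0 hζ1
  have hdev := hT.lintegral_deviation_le hR hf hζ0 hα hτ hlip hp hχ0 hχp he0 he k
  have href := lintegral_mean_exactTraj_le hTm hζ0 hζ1 hlip hxs hR.measurable_active hp
    hq0 hq hr hR.prob_active x₀ k
  rw [← hχ] at href
  have hYm : Measurable (exactTraj (fun i u => u - α • gradient (f i) u) active
      (fun i => x₀ i - α • gradient (f i) (x₀ i)) k) :=
    (measurable_exactTraj hTm hR.measurable_active _ k).mono (ℱ.le _) le_rfl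
  have hym : Measurable (y k) := (hT.adapted hR k).2.mono (ℱ.le _) le_rfl
  have hS1 : 1 ≤ ∑ j ∈ Finset.range (k + 1), χ ^ j := by
    rw [Finset.sum_range_succ', pow_zero]
    exact le_add_of_nonneg_left (Finset.sum_nonneg fun j _ => by positivity)
  have hατ : 0 ≤ α * τ := mul_nonneg hα hτ
  have hB0 : 0 ≤ (α * τ + e) * ∑ j ∈ Finset.range (k + 1), χ ^ j - e := by nlinarith
  refine (lintegral_three_errors_le hym hYm he0 (Real.sqrt_nonneg _) hB0 (he k) href hdev).trans
    (ENNReal.ofReal_le_ofReal ?_)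
  have hD0 := stackNorm_nonneg fun i => x₀ i - xs
  have hN : (0 : ℝ) < Fintype.card V := by exact_mod_cast Fintype.card_pos
  have hκ1 : 1 ≤ (⨆ i, p i) / (⨅ i, p i) := by
    rw [one_le_div hq0]
    exact (hq (Classical.arbitrary V)).trans (hr _)
  rw [mul_add, mul_add, ← Real.sqrt_mul hN.le, mul_inv_cancel_left₀ hN.ne',
    Real.sqrt_mul (by linarith), Real.sqrt_sq (by positivity)]
  have h4 := Real.one_le_sqrt.2 hκ1
  have h5 : 0 ≤ (√(Fintype.card V : ℝ) * e + α * τ * √(Fintype.card V : ℝ)) *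
      ∑ j ∈ Finset.range (k + 1), χ ^ j := by positivity
  linarith [mul_le_mul_of_nonneg_right h4 h5]

end Convergence

end FTQC

theorem proposition1 {V : Type*} [Fintype V] [DecidableEq V] (G : SimpleGraph V)
    [DecidableRel G.Adj] (hG : G.Connected) (ρ : ℝ) (hρ : 0 < ρ) (c : ℝ) (hc : 0 < c) :
    ∃ μ C : ℝ, 0 < μ ∧ μ < 1 ∧ 0 < C ∧
      ∀ (n : ℕ) (_ : 0 < n) (Δ : ℝ) (_ : 0 < Δ)
        (lamL lamU α : ℝ) (_ : 0 < lamL) (_ : 0 < α) (_ : α < 2 / lamU)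
        (f : V → FTQC.Vec n → ℝ) (_ : ∀ i, FTQC.StronglyConvexSmooth lamL lamU (f i))
        (xs : FTQC.Vec n) (_ : IsMinOn (fun u => ∑ i, f i u) Set.univ xs)
        (p : V → ℝ) (_ : ∀ i, 0 < p i ∧ p i ≤ 1) (τ : ℝ) (_ : 0 ≤ τ)
        {Ω Ξ : Type*} [MeasurableSpace Ω] [MeasurableSpace Ξ]
        (P : Measure Ω) [IsProbabilityMeasure P]
        (ℱ : Filtration ℕ (inferInstance : MeasurableSpace Ω))
        (grad : V → FTQC.Vec n → Ξ → FTQC.Vec n) (ξ : ℕ → V → Ω → Ξ)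
        (active : ℕ → V → Set Ω) (z₀ : ℕ → Ω → FTQC.EdgeVec G n) (L : ℕ → V → Ω → ℕ)
        (_ : FTQC.RandomSetup P ℱ f p τ grad ξ active z₀ L)
        (x₀ : V → FTQC.Vec n) (x y : ℕ → Ω → V → FTQC.Vec n)
        (_ : FTQC.IsTrajectory G ρ Δ (c * Δ) μ α grad ξ active z₀ L x₀ x y),
        FTQC.chi α lamL lamU p < 1 ∧
        (0 < FTQC.chi α lamL lamU p ∨ (FTQC.zeta α lamL lamU = 0 ∧ ∀ i, p i = 1)) ∧
        ∀ k : ℕ, 0 < k →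
          Integrable (fun ω => FTQC.stackNorm (fun i => x k ω i - xs)) P ∧
          ∫ ω, FTQC.stackNorm (fun i => x k ω i - xs) ∂P ≤
            √((⨆ i, p i) / (⨅ i, p i)) *
              (FTQC.chi α lamL lamU p ^ k * FTQC.stackNorm (fun i => x₀ i - xs) +
                (FTQC.coordError G n Δ C μ + α * τ * √(Fintype.card V : ℝ)) *
                  ((1 - FTQC.chi α lamL lamU p ^ k) / (1 - FTQC.chi α lamL lamU p))) := by
  obtain ⟨μ, C, hμ0, hμ1, hC, hcoord⟩ := FTQC.exists_coordination_bound hG hρ hc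
  refine ⟨μ, C, hμ0, hμ1, hC, ?_⟩
  intro n hn Δ hΔ lamL lamU α hlamL hα hαU f hf xs hxs p hp τ hτ Ω Ξ _ _ P _ ℱ grad ξ active z₀ L
    hR x₀ x y hT
  have hV : Nonempty V := hG.nonempty
  have : Nonempty (Fin n) := ⟨⟨0, hn⟩⟩
  have hmM : lamL ≤ lamU := FTQC.le_of_strongConvex_of_lipschitz_gradient
    (hf hV.some).differentiable (hf hV.some).strongConvex (hf hV.some).smooth
  have hζ1 : FTQC.zeta α lamL lamU < 1 := FTQC.zeta_lt_one hlamL hmM hα hαU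
  have hχ1 := FTQC.chi_lt_one hζ1 hp
  refine ⟨hχ1, FTQC.chi_pos_or hp, ?_⟩
  have hlip : ∀ i u v, ‖(u - α • gradient (f i) u) - (v - α • gradient (f i) v)‖ ≤
      FTQC.zeta α lamL lamU * ‖u - v‖ := fun i u v =>
    FTQC.norm_gradientStep_sub_le (hf i).differentiable (hf i).strongConvex (hf i).smooth hmM hα u v
  have hgm : ∀ i, Measurable (gradient (f i)) := fun i =>
    (LipschitzWith.of_dist_le' (K := lamU) fun u v => by
      rw [dist_eq_norm, dist_eq_norm]; exact (hf i).smooth u v).continuous.measurable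
  have hmean : FTQC.mean (fun i => xs - α • gradient (f i) xs) = xs :=
    FTQC.mean_const_sub xs _ α (FTQC.sum_gradient_eq_zero (fun i => (hf i).differentiable) hxs)
  have he0 : 0 ≤ C * FTQC.quantError G n Δ / (1 - μ) :=
    div_nonneg (mul_nonneg hC.le (FTQC.quantError_nonneg hΔ)) (sub_nonneg.2 hμ1.le)
  have hxe : ∀ k ω i, ‖x (k + 1) ω i - FTQC.mean (y k ω)‖ ≤
      C * FTQC.quantError G n Δ / (1 - μ) := by
    intro k ω i
    rw [hT.coordination k ω i]
    exact hcoord n hn Δ hΔ _ _ _ (hT.stopped k ω i) i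
  intro k hk
  obtain ⟨k, rfl⟩ := Nat.exists_eq_succ_of_ne_zero hk.ne'
  have hbound := hT.lintegral_stackNorm_le hR hgm (FTQC.zeta_nonneg α lamL lamU) hζ1.le hα.le hτ
    hlip hmean hp (χ := FTQC.chi α lamL lamU p) rfl he0 hxe k
  have hχ0 : 0 ≤ FTQC.chi α lamL lamU p := Real.sqrt_nonneg _
  have hgeom : ∑ j ∈ Finset.range (k + 1), FTQC.chi α lamL lamU p ^ j =
      (1 - FTQC.chi α lamL lamU p ^ (k + 1)) / (1 - FTQC.chi α lamL lamU p) := by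
    rw [geom_sum_eq hχ1.ne, ← neg_sub 1, ← neg_sub 1, neg_div_neg_eq]
  have hγ : FTQC.coordError G n Δ C μ =
      √(Fintype.card V : ℝ) * (C * FTQC.quantError G n Δ / (1 - μ)) := by
    rw [FTQC.coordError]; ring
  have hmeas : Measurable fun ω => FTQC.stackNorm fun i => x (k + 1) ω i - xs :=
    FTQC.measurable_stackNorm_sub ((hT.adapted hR (k + 1)).1.mono (ℱ.le _) le_rfl) xs
  have hnn : 0 ≤ᵐ[P] fun ω => FTQC.stackNorm fun i => x (k + 1) ω i - xs :=
    Filter.Eventually.of_forall fun ω => FTQC.stackNorm_nonneg _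
  refine ⟨⟨hmeas.aestronglyMeasurable, ?_⟩, ?_⟩
  · rw [hasFiniteIntegral_iff_ofReal hnn]
    exact hbound.trans_lt ENNReal.ofReal_lt_top
  · rw [Nat.succ_eq_add_one, ← hgeom, hγ,
      integral_eq_lintegral_of_nonneg_ae hnn hmeas.aestronglyMeasurable]
    refine ENNReal.toReal_le_of_le_ofReal ?_ hbound
    have hD0 := FTQC.stackNorm_nonneg fun i => x₀ i - xs
    positivity
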